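/- Theorem (General fixed-point set stabilization). Let $\mathcal{H}$ be a finite-dimensional complex Hilbert space, $\mathcal{B}(\mathcal{H})$ the space of linear operators on it and $\mathcal{D}(\mathcal{H})$ the set of states (positive semidefinite operators of trace one). For a linear map $\mathcal{E}$ on $\mathcal{B}(\mathcal{H})$ put $\mathrm{fix}(\mathcal{E})=\{X:\mathcal{E}(X)=X\}$. A CPTP fixed-point set is a set of the form $\mathrm{fix}(\mathcal{E})$ with $\mathcal{E}$ completely positive and trace preserving (CPTP), and a CPTP projection onto a linear subspace $\mathcal{A}\subseteq\mathcal{B}(\mathcal{H})$ is an idempotent CPTP map with range $\mathcal{A}$. The support $\mathrm{supp}(\mathcal{A})\subseteq\mathcal{H}$ is the smallest subspace containing $(\ker X)^\perp$ for every $X\in\mathcal{A}$. Let $\mathcal{A}_1,\dots,\mathcal{A}_r$ be CPTP fixed-point sets such that $\hat{\mathcal{A}}=\bigcap_{i=1}^r\mathcal{A}_i$ is not $\{0\}$ and satisfies $$\mathrm{supp}(\hat{\mathcal{A}})=\bigcap_{i=1}^r\mathrm{supp}(\mathcal{A}_i).$$ Then there exist CPTP projections $\mathcal{E}_1,\dots,\mathcal{E}_r$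 onto $\mathcal{A}_1,\dots,\mathcal{A}_r$ and a CPTP projection $\mathcal{E}_{\hat{\mathcal{A}}}$ onto $\hat{\mathcal{A}}$ such that, for every $\tau\in\mathcal{D}(\mathcal{H})$, $$\lim_{n\to\infty}(\mathcal{E}_r\circ\cdots\circ\mathcal{E}_1)^n(\tau)=\mathcal{E}_{\hat{\mathcal{A}}}(\tau).$$ Moreover, the maps can be taken of the form $\mathcal{E}_i=\mathcal{E}_i^1\circ\mathcal{E}_i^0$ with $$\mathcal{E}_i^0(X)=P_iXP_i+\frac{\mathrm{Tr}(P_i^\perp X)}{\mathrm{Tr}(P_i)}P_i,\qquad \mathcal{E}_i^1=\mathcal{E}_{\mathcal{A}_i}\oplus\mathcal{I},$$ where $P_i$ is the orthogonal projection onto $\mathrm{supp}(\mathcal{A}_i)$, $P_i^\perp=I-P_i$, $\mathcal{E}_{\mathcal{A}_i}$ is a CPTP projection of $\mathcal{B}(\mathrm{supp}(\mathcal{A}_i))$ onto $\mathcal{A}_i$ (regarded as a set of operators on $\mathrm{supp}(\mathcal{A}_i)$), $\mathcal{I}$ is the identity map on operators on $\mathrm{supp}(\mathcal{A}_i)^\perp$,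 and the direct sum sends the off-diagonal blocks to zero. -/

import Mathlib

noncomputable section

namespace QuantumProjections

open scoped CStarAlgebra

/-- The algebra `B(H)` of (bounded) linear operators on a Hilbert space. -/
abbrev Op (H : Type*) [NormedAddCommGroup H] [InnerProductSpace ℂ H] : Type _ :=
  H →L[ℂ] H

/-- Linear maps from `B(H)` to itself. -/
abbrev SuperOp (H : Type*) [NormedAddCommGroup H] [InnerProductSpace ℂ H] : Type _ :=
  Op H →ₗ[ℂ] Op H

section Channels

variable {H : Type*} [NormedAddCommGroup H] [InnerProductSpace ℂ H] [FiniteDimensional ℂ H]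

/-- The trace of an operator. -/
def tr : Op H →ₗ[ℂ] ℂ :=
  LinearMap.trace ℂ H ∘ₗ ContinuousLinearMap.coeLM ℂ

/-- Density operators: positive semidefinite operators of trace one. -/
def IsState (τ : Op H) : Prop :=
  0 ≤ τ ∧ tr τ = 1

/-- Completely positive trace-preserving maps on `B(H)`. -/
def IsCPTP [CompleteSpace H] (E : SuperOp H) : Prop :=
  (∃ φ : Op H →CP Op H, φ.toLinearMap = E) ∧ ∀ X, tr (E X) = tr X

/-- The set of fixed points of a linear map on `B(H)`. -/
def fix (E : SuperOp H) : Submodule ℂ (Op H) :=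
  LinearMap.eqLocus E LinearMap.id

/-- A set of operators that is the fixed-point set of some CPTP map. -/
def IsCPTPFixedPointSet [CompleteSpace H] (A : Submodule ℂ (Op H)) : Prop :=
  ∃ E : SuperOp H, IsCPTP E ∧ fix E = A

/-- `E` is a CPTP projection (an idempotent CPTP map) onto the set of operators `A`. -/
def IsCPTPProjectionOnto [CompleteSpace H] (E : SuperOp H) (A : Submodule ℂ (Op H)) : Prop :=
  IsCPTP E ∧ E ∘ₗ E = E ∧ LinearMap.range E = A

/-- The support of a set of operators: the smallest subspace containing the support
`(ker X)ᗮ` of each of its elements `X`. -/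
def supp (A : Submodule ℂ (Op H)) : Submodule ℂ H :=
  ⨆ X ∈ A, (LinearMap.ker X.toLinearMap)ᗮ

/-- The cycle `E_r ∘ ⋯ ∘ E_1`, in which `E_1` is applied first; the identity if `r = 0`. -/
def cycle {r : ℕ} (E : Fin r → SuperOp H) : Module.End ℂ (Op H) :=
  (List.ofFn E).reverse.prod

/-- `X ↦ P X P + Tr(P^⊥ X) P / Tr P`, where `P` is the orthogonal projection onto `K`. -/
def restrictTo (K : Submodule ℂ H) : SuperOp H where
  toFun X := K.starProjection * X * K.starProjection +
    (tr (Kᗮ.starProjection * X) / tr K.starProjection) • K.starProjection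
  map_add' X Y := by
    simp only [mul_add, add_mul, map_add, add_div, add_smul]
    abel
  map_smul' c X := by
    simp only [mul_smul_comm, smul_mul_assoc, map_smul, smul_eq_mul, mul_div_assoc, mul_smul,
      smul_add, RingHom.id_apply]

/-- The inclusion of `B(K)` into `B(H)`: extension by zero on the orthogonal complement. -/
def extend (K : Submodule ℂ H) : Op K →ₗ[ℂ] Op H where
  toFun Y := K.subtypeL ∘L Y ∘L K.orthogonalProjectionOnto
  map_add' X Y := by ext v; simp
  map_smul' c X := by ext v; simp

/-- The compression of an operator on `H` to the subspace `K`. -/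
def compress (K : Submodule ℂ H) : Op H →ₗ[ℂ] Op K where
  toFun X := K.orthogonalProjectionOnto ∘L X ∘L K.subtypeL
  map_add' X Y := by ext v; simp
  map_smul' c X := by ext v; simp

/-- The direct sum of a linear map `G` on `B(K)` and of the identity map on `B(Kᗮ)`, with
the off-diagonal blocks sent to zero. -/
def sumId (K : Submodule ℂ H) (G : SuperOp K) : SuperOp H :=
  extend K ∘ₗ G ∘ₗ compress K + extend Kᗮ ∘ₗ compress Kᗮ

end Channels

end QuantumProjections

end

open QuantumProjections Filter Topology

set_option linter.unusedSectionVars false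

namespace QuantumProjections

open scoped CStarAlgebra ComplexOrder

/-! ### Trace pairing, positivity and duals of positive trace-preserving maps -/

section TraceForm

variable {H : Type*} [NormedAddCommGroup H] [InnerProductSpace ℂ H] [FiniteDimensional ℂ H]

/-! Write `K i` for the support of `A i` and `L` for that of the intersection. Each `E i` is
`restrictTo (K i)` followed by a projection `Φ` onto `A i`, a limit of Cesàro means
(`IsCPTP.exists_projection`). Orbits of the cycle `T` are bounded, so orbit closures are compact,
and two Lyapunov functions are minimized there.

The first is the weight `tr (P_{Lᗮ} X)`. No `E i` increases it, and one that preserves it on `X ≥ 0`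
forces `X` to live on `K i` and does not enlarge the kernel (`restrict_project_step`). Among the
minimizers of the weight, one with smallest kernel has its kernel unchanged throughout a cycle,
hence lives on every `K i`. By the support hypothesis it lives on `L`, and the minimal weight is
zero.

The second acts on the part of the orbit closure living on `L`. Choose a positive `σ` in the
intersection with support exactly `L` (`IsPosPartClosed.exists_ker_eq`). The squared Hilbert–Schmidt
norm of `σ^{-1/2} X` does not increase under a CPTP map fixing `σ` (`IsCPTP.hsSq_le`), and for an
idempotent map equality holds only at fixed points (`IsCPTP.apply_eq_of_hsSq_le`). A minimizer is
therefore fixed by every `E i`. Since the powers of `T` are uniformly bounded, a fixed point in the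
orbit closure is the limit of the orbit. -/

theorem tr_mul_comm (X Y : Op H) : tr (X * Y) = tr (Y * X) :=
  LinearMap.trace_mul_comm ℂ (X : H →ₗ[ℂ] H) (Y : H →ₗ[ℂ] H)

theorem tr_eq_sum_inner {ι : Type*} [Fintype ι] (b : OrthonormalBasis ι ℂ H) (X : Op H) :
    tr X = ∑ i, inner ℂ (b i) (X (b i)) :=
  LinearMap.trace_eq_sum_inner (X : H →ₗ[ℂ] H) b

theorem tr_rankOne (x y : H) : tr (InnerProductSpace.rankOne ℂ x y) = inner ℂ y x :=
  InnerProductSpace.trace_rankOne x y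

variable [CompleteSpace H]

theorem nonneg_iff_exists_star_mul_self {X : Op H} : 0 ≤ X ↔ ∃ a : Op H, X = star a * a :=
  CStarAlgebra.nonneg_iff_eq_star_mul_self

theorem inner_star_left (a : Op H) (x y : H) : inner ℂ (star a x) y = inner ℂ x (a y) := by
  rw [ContinuousLinearMap.star_eq_adjoint, ContinuousLinearMap.adjoint_inner_left]

theorem inner_star_right (a : Op H) (x y : H) : inner ℂ x (star a y) = inner ℂ (a x) y := by
  rw [ContinuousLinearMap.star_eq_adjoint, ContinuousLinearMap.adjoint_inner_right]

/-- In the order on `ℂ`, nonnegative numbers are real, and over `ℂ` a real quadratic form already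
forces self-adjointness. -/
theorem nonneg_iff_inner {X : Op H} : 0 ≤ X ↔ ∀ x, 0 ≤ inner ℂ x (X x) := by
  rw [ContinuousLinearMap.nonneg_iff_isPositive, ContinuousLinearMap.isPositive_iff']
  constructor
  · rintro ⟨hs, h⟩ x
    have := h x
    rwa [← hs.star_eq, inner_star_left] at this
  · intro h
    have hs : IsSelfAdjoint X := by
      rw [ContinuousLinearMap.isSelfAdjoint_iff_isSymmetric, LinearMap.isSymmetric_iff_inner_map_self_real]
      intro v
      have h1 := h v
      rw [Complex.nonneg_iff] at h1
      have e : inner ℂ (X v) v = (starRingEnd ℂ) (inner ℂ v (X v)) := (inner_conj_symm _ _).symm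
      rw [ContinuousLinearMap.coe_coe, e, Complex.conj_conj, Complex.ext_iff]
      exact ⟨rfl, by rw [Complex.conj_im, ← h1.2, neg_zero]⟩
    refine ⟨hs, fun x => ?_⟩
    rw [← hs.star_eq, inner_star_left]
    exact h x

theorem tr_star_mul_self {ι : Type*} [Fintype ι] (b : OrthonormalBasis ι ℂ H) (a : Op H) :
    tr (star a * a) = ((∑ i, ‖a (b i)‖ ^ 2 : ℝ) : ℂ) := by
  rw [tr_eq_sum_inner b]
  push_cast
  refine Finset.sum_congr rfl fun i _ => ?_
  refine (inner_star_right a (b i) (a (b i))).trans ?_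
  rw [inner_self_eq_norm_sq_to_K]
  rfl

theorem eq_zero_of_tr_star_mul_self {a : Op H} (h : (tr (star a * a)).re = 0) : a = 0 := by
  rw [tr_star_mul_self (stdOrthonormalBasis ℂ H), Complex.ofReal_re,
    Finset.sum_eq_zero_iff_of_nonneg fun i _ => by positivity] at h
  have : (a : H →ₗ[ℂ] H) = 0 :=
    (stdOrthonormalBasis ℂ H).toBasis.ext fun i => by simpa using h i (Finset.mem_univ i)
  ext v
  exact LinearMap.congr_fun this v

theorem tr_re_nonneg {X : Op H} (h : 0 ≤ X) : 0 ≤ (tr X).re := by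
  obtain ⟨a, rfl⟩ := nonneg_iff_exists_star_mul_self.1 h
  rw [tr_star_mul_self (stdOrthonormalBasis ℂ H), Complex.ofReal_re]
  positivity

theorem tr_eq_ofReal {X : Op H} (h : 0 ≤ X) : tr X = ((tr X).re : ℂ) := by
  obtain ⟨a, rfl⟩ := nonneg_iff_exists_star_mul_self.1 h
  rw [tr_star_mul_self (stdOrthonormalBasis ℂ H), Complex.ofReal_re]

/-- Cyclicity turns the trace of a product of two positive operators into a squared Hilbert–Schmidt
norm: it is nonnegative, and vanishes only if the product does. -/
theorem tr_star_mul_self_mul_star_mul_self (a b : Op H) :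
    tr (star a * a * (star b * b)) = tr (star (a * star b) * (a * star b)) := by
  rw [← mul_assoc, tr_mul_comm]
  simp only [star_mul, star_star, mul_assoc]

theorem tr_mul_re_nonneg {D X : Op H} (hD : 0 ≤ D) (hX : 0 ≤ X) : 0 ≤ (tr (D * X)).re := by
  obtain ⟨a, rfl⟩ := nonneg_iff_exists_star_mul_self.1 hD
  obtain ⟨b, rfl⟩ := nonneg_iff_exists_star_mul_self.1 hX
  rw [tr_star_mul_self_mul_star_mul_self]
  exact tr_re_nonneg (star_mul_self_nonneg _)

theorem mul_eq_zero_of_tr_mul {D X : Op H} (hD : 0 ≤ D) (hX : 0 ≤ X)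
    (h : (tr (D * X)).re = 0) : D * X = 0 := by
  obtain ⟨a, rfl⟩ := nonneg_iff_exists_star_mul_self.1 hD
  obtain ⟨b, rfl⟩ := nonneg_iff_exists_star_mul_self.1 hX
  rw [tr_star_mul_self_mul_star_mul_self] at h
  have := eq_zero_of_tr_star_mul_self h
  rw [mul_assoc, ← mul_assoc a, this, zero_mul, mul_zero]

theorem eq_zero_of_tr_eq_zero {X : Op H} (hX : 0 ≤ X) (h : (tr X).re = 0) : X = 0 := by
  simpa using mul_eq_zero_of_tr_mul (D := 1) zero_le_one hX (by simpa using h)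

theorem norm_le_tr {X : Op H} (hX : 0 ≤ X) : ‖X‖ ≤ (tr X).re := by
  obtain ⟨a, rfl⟩ := nonneg_iff_exists_star_mul_self.1 hX
  set b := stdOrthonormalBasis ℂ H
  rw [tr_star_mul_self b, Complex.ofReal_re, CStarRing.norm_star_mul_self]
  set s := ∑ i, ‖a (b i)‖ ^ 2
  have hs : 0 ≤ s := by positivity
  rw [← sq, ← Real.le_sqrt (norm_nonneg _) hs]
  refine a.opNorm_le_bound (Real.sqrt_nonneg _) fun v => ?_
  refine abs_le_of_sq_le_sq' ?_ (by positivity) |>.2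
  rw [mul_pow, Real.sq_sqrt hs, ← b.sum_sq_norm_inner_right v, mul_comm]
  have h1 : ‖a v‖ ≤ ∑ i, ‖inner ℂ (b i) v‖ * ‖a (b i)‖ := by
    conv_lhs => rw [← b.sum_repr' v, map_sum]
    refine (norm_sum_le _ _).trans (Finset.sum_le_sum fun i _ => ?_)
    rw [map_smul, norm_smul]
  calc ‖a v‖ ^ 2 ≤ (∑ i, ‖inner ℂ (b i) v‖ * ‖a (b i)‖) ^ 2 := by gcongr
    _ ≤ _ := Finset.sum_mul_sq_le_sq_mul_sq _ _ _

theorem tr_re_le_norm (X : Op H) : (tr X).re ≤ Module.finrank ℂ H * ‖X‖ := by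
  set b := stdOrthonormalBasis ℂ H
  rw [tr_eq_sum_inner b, Complex.re_sum]
  calc ∑ i, (inner ℂ (b i) (X (b i))).re ≤ ∑ _i : Fin (Module.finrank ℂ H), ‖X‖ := by
        refine Finset.sum_le_sum fun i _ => (Complex.re_le_norm _).trans ?_
        refine (norm_inner_le_norm _ _).trans ?_
        simpa using X.le_opNorm (b i)
    _ = _ := by simp

/-- The pairing `(Y, X) ↦ tr (Y X)` identifies operators with functionals. -/
theorem exists_tr_mul_eq (φ : Op H →ₗ[ℂ] ℂ) : ∃ D : Op H, ∀ X, tr (D * X) = φ X := by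
  let B : Op H →ₗ[ℂ] Module.Dual ℂ (Op H) := (LinearMap.mul ℂ (Op H)).compr₂ tr
  have hB : Function.Injective B := by
    rw [injective_iff_map_eq_zero]
    intro D hD
    have h1 : tr (D * star D) = 0 := LinearMap.congr_fun hD (star D)
    rw [tr_mul_comm] at h1
    exact eq_zero_of_tr_star_mul_self (by rw [h1]; rfl)
  have : Function.Surjective B :=
    (LinearMap.injective_iff_surjective_of_finrank_eq_finrank
      (Subspace.dual_finrank_eq (K := ℂ) (V := Op H)).symm).1 hB
  obtain ⟨D, hD⟩ := this φ
  exact ⟨D, fun X => LinearMap.congr_fun hD X⟩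

theorem inner_eq_tr_rankOne (D : Op H) (v w : H) :
    inner ℂ w (D v) = tr (D * InnerProductSpace.rankOne ℂ v w) := by
  rw [← tr_rankOne]
  congr 1
  exact (InnerProductSpace.comp_rankOne v w D).symm

/-- The adjoint of a positive trace-preserving map, on a single operator. -/
theorem exists_dual {E : SuperOp H} (hpos : ∀ X, 0 ≤ X → 0 ≤ E X)
    (htr : ∀ X, tr (E X) = tr X) {Y : Op H} (hY : 0 ≤ Y) (hY1 : Y ≤ 1) :
    ∃ D : Op H, 0 ≤ D ∧ D ≤ 1 ∧ ∀ X, tr (D * X) = tr (Y * E X) := by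
  obtain ⟨D, hD⟩ := exists_tr_mul_eq (tr ∘ₗ LinearMap.mulLeft ℂ Y ∘ₗ E)
  replace hD : ∀ X, tr (D * X) = tr (Y * E X) := hD
  have hr (v : H) : 0 ≤ InnerProductSpace.rankOne ℂ v v := by
    rw [ContinuousLinearMap.nonneg_iff_isPositive]
    exact InnerProductSpace.isPositive_rankOne_self v
  have key (Y : Op H) (hY : 0 ≤ Y) (v : H) :
      0 ≤ tr (Y * E (InnerProductSpace.rankOne ℂ v v)) := by
    obtain ⟨a, rfl⟩ := nonneg_iff_exists_star_mul_self.1 hY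
    obtain ⟨b, hb⟩ := nonneg_iff_exists_star_mul_self.1 (hpos _ (hr v))
    rw [hb, tr_star_mul_self_mul_star_mul_self, tr_star_mul_self (stdOrthonormalBasis ℂ H)]
    exact_mod_cast Finset.sum_nonneg fun i _ => by positivity
  refine ⟨D, ?_, ?_, hD⟩
  · rw [nonneg_iff_inner]
    intro v
    rw [inner_eq_tr_rankOne, hD]
    exact key Y hY v
  · rw [← sub_nonneg, nonneg_iff_inner]
    intro v
    rw [inner_eq_tr_rankOne, sub_mul, map_sub, hD, one_mul, ← htr, ← map_sub, ← one_sub_mul]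
    exact key _ (sub_nonneg.2 hY1) v

theorem star_starProjection (K : Submodule ℂ H) : star K.starProjection = K.starProjection :=
  isStarProjection_starProjection.isSelfAdjoint

theorem starProjection_mul_self (K : Submodule ℂ H) :
    K.starProjection * K.starProjection = K.starProjection :=
  isStarProjection_starProjection.isIdempotentElem

theorem starProjection_nonneg (K : Submodule ℂ H) : 0 ≤ K.starProjection :=
  isStarProjection_starProjection.nonneg

theorem starProjection_le_one (K : Submodule ℂ H) : K.starProjection ≤ 1 :=
  isStarProjection_starProjection.le_one

theorem starProjection_orthogonal_eq (K : Submodule ℂ H) :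
    Kᗮ.starProjection = 1 - K.starProjection := by
  ext v
  simp [Submodule.starProjection_orthogonal]

theorem starProjection_mul_eq_self_iff {K : Submodule ℂ H} {X : Op H} :
    K.starProjection * X = X ↔ ∀ v, X v ∈ K := by
  simp only [← Submodule.starProjection_eq_self_iff]
  exact ⟨fun h v => by conv_rhs => rw [← h]
                       rfl, fun h => by ext v; exact h v⟩

/-- If `σ` is a fixed positive operator of a positive trace-preserving map, then
the weight on `ker σ` cannot increase. -/
theorem exists_dual_ker {E : SuperOp H} (hpos : ∀ X, 0 ≤ X → 0 ≤ E X)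
    (htr : ∀ X, tr (E X) = tr X) {σ : Op H} (hσ : 0 ≤ σ) (hfix : E σ = σ) :
    ∃ D : Op H, D ≤ (LinearMap.ker σ.toLinearMap).starProjection ∧
      ∀ X, tr (D * X) = tr ((LinearMap.ker σ.toLinearMap).starProjection * E X) := by
  set q := (LinearMap.ker σ.toLinearMap).starProjection with hq
  obtain ⟨D, hD0, hD1, hD⟩ := exists_dual hpos htr
    (starProjection_nonneg (LinearMap.ker σ.toLinearMap))
    (starProjection_le_one (LinearMap.ker σ.toLinearMap))
  refine ⟨D, ?_, hD⟩
  have hσq : σ * q = 0 := by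
    ext v
    exact (Submodule.starProjection_apply_mem (LinearMap.ker σ.toLinearMap) v)
  -- `tr (D σ) = tr (q E σ) = tr (q σ) = 0`, so `D` lives on `ker σ`; compressing `D ≤ 1` by `q`
  -- then gives `D ≤ q`.
  have hDσ : D * σ = 0 := by
    refine mul_eq_zero_of_tr_mul hD0 hσ ?_
    rw [hD, hfix, ← hq, tr_mul_comm, hσq, map_zero]
    rfl
  have hσD : σ * D = 0 := by
    rw [← star_inj, star_mul, hD0.isSelfAdjoint.star_eq, hσ.isSelfAdjoint.star_eq, hDσ, star_zero]
  have hqD : q * D = D := starProjection_mul_eq_self_iff.2 fun v => by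
    rw [LinearMap.mem_ker]
    exact DFunLike.congr_fun hσD v
  have hDq : D * q = D := by
    rw [← star_inj, star_mul, hD0.isSelfAdjoint.star_eq, star_starProjection, ← hq, hqD]
  rw [← sub_nonneg] at hD1 ⊢
  have := star_left_conjugate_nonneg hD1 q
  rwa [star_starProjection, ← hq, mul_sub, sub_mul, mul_one, hqD, hDq, starProjection_mul_self] at this

end TraceForm

theorem exists_eq_star_mul_self {A : Type*} [NonUnitalCStarAlgebra A] [PartialOrder A]
    [StarOrderedRing A] {a : A} (ha : 0 ≤ a) : ∃ b, a = star b * b :=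
  CStarAlgebra.nonneg_iff_eq_star_mul_self.1 ha

/-! ### Completely positive maps between operator algebras -/

section CompletelyPositive

variable {H₁ H₂ H₃ : Type*} [NormedAddCommGroup H₁] [InnerProductSpace ℂ H₁]
  [FiniteDimensional ℂ H₁] [CompleteSpace H₁]
  [NormedAddCommGroup H₂] [InnerProductSpace ℂ H₂] [FiniteDimensional ℂ H₂] [CompleteSpace H₂]
  [NormedAddCommGroup H₃] [InnerProductSpace ℂ H₃] [FiniteDimensional ℂ H₃] [CompleteSpace H₃]

/-- Complete positivity of a linear map between operator algebras, as a proposition. -/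
def IsCP (E : Op H₁ →ₗ[ℂ] Op H₂) : Prop :=
  ∀ (k : ℕ) (M : CStarMatrix (Fin k) (Fin k) (Op H₁)), 0 ≤ M → 0 ≤ M.map E

theorem isCPTP_iff {E : SuperOp H₁} : IsCPTP E ↔ IsCP E ∧ ∀ X, tr (E X) = tr X := by
  refine and_congr_left fun _ => ⟨?_, fun h => ⟨⟨E, h⟩, rfl⟩⟩
  rintro ⟨φ, rfl⟩
  exact φ.map_cstarMatrix_nonneg'

theorem IsCP.comp {E : Op H₂ →ₗ[ℂ] Op H₃} {F : Op H₁ →ₗ[ℂ] Op H₂} (hE : IsCP E) (hF : IsCP F) :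
    IsCP (E ∘ₗ F) :=
  fun k M hM => hE k _ (hF k M hM)

theorem IsCP.add {E F : Op H₁ →ₗ[ℂ] Op H₂} (hE : IsCP E) (hF : IsCP F) : IsCP (E + F) :=
  fun k M hM => add_nonneg (hE k M hM) (hF k M hM)

theorem isCP_zero : IsCP (0 : Op H₁ →ₗ[ℂ] Op H₂) :=
  fun _ _ _ => le_rfl

theorem isCP_id : IsCP (LinearMap.id : SuperOp H₁) :=
  fun _ _ hM => hM

theorem IsCP.sum {ι : Type*} (s : Finset ι) {E : ι → Op H₁ →ₗ[ℂ] Op H₂}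
    (hE : ∀ i ∈ s, IsCP (E i)) : IsCP (∑ i ∈ s, E i) :=
  Finset.sum_induction E IsCP (fun _ _ => IsCP.add) isCP_zero hE

theorem IsCP.of_tendsto {ι : Type*} {l : Filter ι} [l.NeBot] {F : ι → Op H₁ →ₗ[ℂ] Op H₂}
    {E : Op H₁ →ₗ[ℂ] Op H₂} (hF : ∀ n, IsCP (F n)) (h : ∀ X, Tendsto (fun n => F n X) l (𝓝 (E X))) :
    IsCP E := by
  intro k M hM
  have h1 : Tendsto (fun n => M.map (F n)) l (𝓝 (M.map E)) :=
    tendsto_pi_nhds.2 fun i => tendsto_pi_nhds.2 fun j => h (M i j)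
  exact ge_of_tendsto' h1 fun n => hF n k M hM

theorem sum_cstarMatrix_apply {ι m n : Type*} (s : Finset ι) (M : ι → CStarMatrix m n (Op H₁))
    (i : m) (j : n) : (∑ k ∈ s, M k) i j = ∑ k ∈ s, M k i j :=
  Matrix.sum_apply i j s M

/-- The Gram matrix is `star N * N`, where `N` has first row `b` and zeros elsewhere. -/
theorem nonneg_of_star_mul {k : ℕ} (b : Fin k → Op H₁) :
    0 ≤ CStarMatrix.ofMatrix (Matrix.of fun i j => star (b i) * b j) := by
  let N : CStarMatrix (Fin k) (Fin k) (Op H₁) :=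
    CStarMatrix.ofMatrix (Matrix.of fun i j => if i.val = 0 then b j else 0)
  convert star_mul_self_nonneg N
  ext1 i j
  rw [CStarMatrix.mul_apply, Finset.sum_eq_single ⟨0, i.pos⟩]
  · simp [N, CStarMatrix.star_apply]
  · intro m _ hm
    have : m.val ≠ 0 := fun h => hm (Fin.ext h)
    simp [N, CStarMatrix.star_apply, this]
  · simp

/-- As the `a i` leave `H₁`, the Gram matrix is split along an orthonormal basis of `H₂`, and each
basis direction is carried back to a fixed unit vector `k₀` of `H₁`. -/
theorem nonneg_of_adjoint_comp {k : ℕ} (a : Fin k → H₁ →L[ℂ] H₂) :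
    0 ≤ CStarMatrix.ofMatrix (Matrix.of fun i j => (a i).adjoint ∘L a j) := by
  rcases subsingleton_or_nontrivial H₁ with hs | hn
  · refine le_of_eq ?_
    ext i j v
    exact Subsingleton.elim _ _
  obtain ⟨k₀, hk⟩ := exists_norm_eq H₁ zero_le_one
  let f := stdOrthonormalBasis ℂ H₂
  let b (m) (i : Fin k) : Op H₁ := InnerProductSpace.rankOne ℂ k₀ ((a i).adjoint (f m))
  have : CStarMatrix.ofMatrix (Matrix.of fun i j => (a i).adjoint ∘L a j) =
      ∑ m, CStarMatrix.ofMatrix (Matrix.of fun i j => star (b m i) * b m j) := by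
    ext1 i j
    rw [sum_cstarMatrix_apply]
    refine ContinuousLinearMap.ext fun v => ext_inner_left ℂ fun w => ?_
    rw [_root_.sum_apply, inner_sum]
    change inner ℂ w ((a i).adjoint (a j v)) = ∑ m, inner ℂ w (star (b m i) (b m j v))
    rw [ContinuousLinearMap.adjoint_inner_right, ← f.sum_inner_mul_inner]
    refine Finset.sum_congr rfl fun m _ => ?_
    rw [inner_star_right]
    simp only [b, InnerProductSpace.rankOne_apply, inner_smul_left, inner_smul_right,
      inner_self_eq_norm_sq_to_K, hk, inner_conj_symm, ContinuousLinearMap.adjoint_inner_left]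
    simp [mul_comm]
  rw [this]
  exact Finset.sum_nonneg fun m _ => nonneg_of_star_mul (b m)

/-- The map `X ↦ V† X V`. -/
noncomputable def conjBy (V : H₁ →L[ℂ] H₂) : Op H₂ →ₗ[ℂ] Op H₁ where
  toFun X := V.adjoint ∘L X ∘L V
  map_add' X Y := by ext v; simp
  map_smul' c X := by ext v; simp

theorem conjBy_apply (V : H₁ →L[ℂ] H₂) (X : Op H₂) : conjBy V X = V.adjoint ∘L X ∘L V := rfl

theorem isCP_conjBy (V : H₁ →L[ℂ] H₂) : IsCP (conjBy V) := by
  intro k M hM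
  obtain ⟨N, rfl⟩ := exists_eq_star_mul_self hM
  have : (star N * N).map (conjBy V) = ∑ m, CStarMatrix.ofMatrix (Matrix.of fun i j =>
      (N m i ∘L V).adjoint ∘L (N m j ∘L V)) := by
    ext1 i j
    rw [sum_cstarMatrix_apply, CStarMatrix.map_apply, CStarMatrix.mul_apply, map_sum]
    refine Finset.sum_congr rfl fun m _ => ?_
    rw [conjBy_apply]
    ext v
    simp [ContinuousLinearMap.adjoint_comp, CStarMatrix.star_apply,
      ContinuousLinearMap.star_eq_adjoint]
  rw [this]
  exact Finset.sum_nonneg fun m _ => nonneg_of_adjoint_comp fun i => N m i ∘L V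

/-- 2-positivity on the Gram matrix of `(s, z)`, tested on the vector `(u, v)`; this is the source
of the Schwarz inequality in `IsCPTP.hsSq_le`. -/
theorem IsCP.inner_nonneg {E : Op H₁ →ₗ[ℂ] Op H₂} (hE : IsCP E) (s z : Op H₁) (u v : H₂) :
    0 ≤ inner ℂ u (E (star s * s) u) + inner ℂ u (E (star s * z) v) +
      (inner ℂ v (E (star z * s) u) + inner ℂ v (E (star z * z) v)) := by
  have h := hE 2 _ (nonneg_of_star_mul ![s, z])
  obtain ⟨N, hN⟩ := exists_eq_star_mul_self h
  have h1 (i j : Fin 2) : E (star (![s, z] i) * ![s, z] j) = ∑ m, star (N m i) * N m j := by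
    have := congrFun (congrFun hN i) j
    rw [CStarMatrix.mul_apply] at this
    exact this
  have h2 (i j : Fin 2) (x y : H₂) : inner ℂ x (E (star (![s, z] i) * ![s, z] j) y) =
      ∑ m, inner ℂ (N m i x) (N m j y) := by
    rw [h1, _root_.sum_apply, inner_sum]
    exact Finset.sum_congr rfl fun m _ => inner_star_right _ _ _
  have h00 := h2 0 0 u u
  have h01 := h2 0 1 u v
  have h10 := h2 1 0 v u
  have h11 := h2 1 1 v v
  simp only [Matrix.cons_val_zero, Matrix.cons_val_one] at h00 h01 h10 h11
  rw [h00, h01, h10, h11, ← Finset.sum_add_distrib, ← Finset.sum_add_distrib,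
    ← Finset.sum_add_distrib]
  refine Finset.sum_nonneg fun m _ => ?_
  rw [← inner_add_right, ← inner_add_right, ← inner_add_left]
  rw [inner_self_eq_norm_sq_to_K, ← RCLike.ofReal_pow]
  exact RCLike.ofReal_nonneg.2 (sq_nonneg _)

theorem IsCP.map_nonneg {E : Op H₁ →ₗ[ℂ] Op H₂} (hE : IsCP E) {X : Op H₁} (hX : 0 ≤ X) :
    0 ≤ E X := by
  let φ : Op H₁ →CP Op H₂ := ⟨E, hE⟩
  exact _root_.map_nonneg φ hX

theorem IsCP.map_star {E : Op H₁ →ₗ[ℂ] Op H₂} (hE : IsCP E) (X : Op H₁) :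
    E (star X) = star (E X) := by
  obtain ⟨x, hx, -, hX⟩ := CStarAlgebra.exists_sum_four_nonneg X
  rw [hX, star_sum, map_sum, map_sum, star_sum]
  refine Finset.sum_congr rfl fun i _ => ?_
  rw [star_smul, map_smul, map_smul, star_smul, (hx i).isSelfAdjoint.star_eq,
    (hE.map_nonneg (hx i)).isSelfAdjoint.star_eq]

end CompletelyPositive

/-! ### Channels, ergodic projections and the block form of the stabilizing maps -/

section Channels

variable {H : Type*} [NormedAddCommGroup H] [InnerProductSpace ℂ H]
  [FiniteDimensional ℂ H] [CompleteSpace H]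

theorem extend_eq_conjBy (K : Submodule ℂ H) : extend K = conjBy K.orthogonalProjectionOnto := by
  ext X v
  simp [extend, conjBy_apply, Submodule.adjoint_orthogonalProjectionOnto]

theorem compress_eq_conjBy (K : Submodule ℂ H) : compress K = conjBy K.subtypeL := by
  ext X v
  simp [compress, conjBy_apply, Submodule.adjoint_subtypeL]

theorem extend_compress (K : Submodule ℂ H) (X : Op H) :
    extend K (compress K X) = K.starProjection * X * K.starProjection :=
  rfl

theorem compress_extend (K : Submodule ℂ H) (Y : Op K) : compress K (extend K Y) = Y := by
  ext v
  simp [compress, extend]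

theorem tr_extend (K : Submodule ℂ H) (Y : Op K) : tr (extend K Y) = tr Y := by
  change LinearMap.trace ℂ H (K.subtype ∘ₗ (Y.toLinearMap ∘ₗ K.orthogonalProjectionOnto.toLinearMap)) = _
  rw [LinearMap.trace_comp_comm']
  have : (Y.toLinearMap ∘ₗ K.orthogonalProjectionOnto.toLinearMap) ∘ₗ K.subtype = Y.toLinearMap := by
    ext v
    simp
  rw [this]
  rfl

theorem isCP_tr_smul {B : Op H} (hB : 0 ≤ B) : IsCP ((tr : Op H →ₗ[ℂ] ℂ).smulRight B) := by
  obtain ⟨b, rfl⟩ := nonneg_iff_exists_star_mul_self.1 hB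
  let e := stdOrthonormalBasis ℂ H
  -- A Kraus decomposition: the sum over `m` produces the trace, the sum over `n` produces `star b *
  -- b`.
  have : (tr : Op H →ₗ[ℂ] ℂ).smulRight (star b * b) =
      ∑ m, ∑ n, conjBy (InnerProductSpace.rankOne ℂ (e m) (star b (e n))) := by
    ext1 X
    simp only [LinearMap.smulRight_apply, LinearMap.sum_apply]
    refine ContinuousLinearMap.ext fun v => ext_inner_left ℂ fun w => ?_
    simp only [_root_.sum_apply, inner_sum, conjBy_apply, ContinuousLinearMap.comp_apply,
      ContinuousLinearMap.adjoint_inner_right, InnerProductSpace.rankOne_apply, inner_smul_left,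
      inner_smul_right, map_smul, inner_conj_symm, inner_star_left,
      _root_.smul_apply]
    rw [tr_eq_sum_inner e, Finset.sum_mul]
    refine Finset.sum_congr rfl fun m _ => ?_
    have h : inner ℂ w ((star b * b) v) = ∑ n, inner ℂ (b w) (e n) * inner ℂ (e n) (b v) := by
      rw [e.sum_inner_mul_inner]
      exact inner_star_right _ _ _
    rw [h, Finset.mul_sum]
    refine Finset.sum_congr rfl fun n _ => ?_
    ring
  rw [this]
  exact IsCP.sum _ fun m _ => IsCP.sum _ fun n _ => isCP_conjBy _

theorem tr_starProjection_ne_zero {K : Submodule ℂ H} (hK : K ≠ ⊥) : tr K.starProjection ≠ 0 := by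
  intro h
  refine hK (eq_bot_iff.2 fun v hv => ?_)
  have h0 := eq_zero_of_tr_eq_zero (starProjection_nonneg K) (by rw [h]; rfl)
  rw [← Submodule.starProjection_eq_self_iff.2 hv, h0]
  simp

theorem inv_tr_smul_starProjection_nonneg (K : Submodule ℂ H) :
    0 ≤ (tr K.starProjection)⁻¹ • K.starProjection := by
  rw [nonneg_iff_inner]
  intro x
  rw [_root_.smul_apply, inner_smul_right]
  refine mul_nonneg ?_ (nonneg_iff_inner.1 (starProjection_nonneg K) x)
  rw [tr_eq_ofReal (starProjection_nonneg K), ← Complex.ofReal_inv]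
  exact_mod_cast inv_nonneg.2 (tr_re_nonneg (starProjection_nonneg K))

theorem tr_starProjection_conj (K : Submodule ℂ H) (X : Op H) :
    tr (K.starProjection * X * K.starProjection) = tr (K.starProjection * X) := by
  rw [tr_mul_comm, ← mul_assoc, starProjection_mul_self]

theorem conjBy_starProjection (K : Submodule ℂ H) (X : Op H) :
    conjBy K.starProjection X = K.starProjection * X * K.starProjection := by
  rw [conjBy_apply, ← ContinuousLinearMap.star_eq_adjoint, star_starProjection]
  rfl

theorem restrictTo_apply (K : Submodule ℂ H) (X : Op H) :
    restrictTo K X = K.starProjection * X * K.starProjection +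
      (tr (Kᗮ.starProjection * X) / tr K.starProjection) • K.starProjection :=
  rfl

theorem isCPTP_restrictTo {K : Submodule ℂ H} (hK : K ≠ ⊥) : IsCPTP (restrictTo K) := by
  rw [isCPTP_iff]
  constructor
  · have : restrictTo K = conjBy K.starProjection +
        (tr : Op H →ₗ[ℂ] ℂ).smulRight ((tr K.starProjection)⁻¹ • K.starProjection) ∘ₗ
          conjBy Kᗮ.starProjection := by
      ext1 X
      rw [LinearMap.add_apply, LinearMap.comp_apply, LinearMap.smulRight_apply,
        conjBy_starProjection, conjBy_starProjection, tr_starProjection_conj, restrictTo_apply,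
        smul_smul, div_eq_mul_inv]
    rw [this]
    exact (isCP_conjBy _).add
      ((isCP_tr_smul (inv_tr_smul_starProjection_nonneg K)).comp (isCP_conjBy _))
  · intro X
    rw [restrictTo_apply, map_add, map_smul, smul_eq_mul,
      div_mul_cancel₀ _ (tr_starProjection_ne_zero hK), tr_starProjection_conj, ← map_add,
      ← add_mul, starProjection_orthogonal_eq, add_sub_cancel, one_mul]

theorem isCPTP_id : IsCPTP (LinearMap.id : SuperOp H) :=
  isCPTP_iff.2 ⟨isCP_id, fun _ => rfl⟩

theorem IsCPTP.comp {E F : SuperOp H} (hE : IsCPTP E) (hF : IsCPTP F) : IsCPTP (E ∘ₗ F) := by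
  rw [isCPTP_iff] at *
  exact ⟨hE.1.comp hF.1, fun X => (hE.2 _).trans (hF.2 X)⟩

theorem IsCPTP.pow {E : SuperOp H} (hE : IsCPTP E) (n : ℕ) : IsCPTP (E ^ n) := by
  induction n with
  | zero => exact isCPTP_id
  | succ n ih => rw [pow_succ']; exact hE.comp ih

theorem IsCPTP.isCP {E : SuperOp H} (hE : IsCPTP E) : IsCP E := (isCPTP_iff.1 hE).1

theorem IsCPTP.map_nonneg {E : SuperOp H} (hE : IsCPTP E) (X : Op H) (hX : 0 ≤ X) : 0 ≤ E X :=
  hE.isCP.map_nonneg hX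

/-- On positive operators the norm is at most the trace, which `E` preserves; the factor 4 counts
the positive pieces of `X`. The constant does not depend on `E`, so it serves all powers at once. -/
theorem IsCPTP.norm_apply_le {E : SuperOp H} (hE : IsCPTP E) (X : Op H) :
    ‖E X‖ ≤ 4 * Module.finrank ℂ H * ‖X‖ := by
  obtain ⟨x, hx, hn, hX⟩ := CStarAlgebra.exists_sum_four_nonneg X
  conv_lhs => rw [hX]
  rw [map_sum]
  calc ‖∑ i : Fin 4, E (Complex.I ^ (i : ℕ) • x i)‖ ≤ ∑ _i : Fin 4, Module.finrank ℂ H * ‖X‖ := by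
        refine (norm_sum_le _ _).trans (Finset.sum_le_sum fun i _ => ?_)
        rw [map_smul, norm_smul, norm_pow, Complex.norm_I, one_pow, one_mul]
        refine (norm_le_tr (hE.map_nonneg _ (hx i))).trans ?_
        rw [hE.2]
        refine (tr_re_le_norm _).trans ?_
        gcongr
        exact hn i
    _ = _ := by simp [mul_assoc]

theorem exists_linearMap_tendsto {ι : Type*} {l : Filter ι} [l.NeBot] (F : ι → SuperOp H)
    (h : ∀ X, ∃ Y, Tendsto (fun n => F n X) l (𝓝 Y)) :
    ∃ Φ : SuperOp H, ∀ X, Tendsto (fun n => F n X) l (𝓝 (Φ X)) := by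
  choose Φ hΦ using h
  refine ⟨⟨⟨Φ, fun X Y => ?_⟩, fun c X => ?_⟩, hΦ⟩
  · refine tendsto_nhds_unique (hΦ _) ?_
    simpa only [map_add] using (hΦ X).add (hΦ Y)
  · refine tendsto_nhds_unique (hΦ _) ?_
    simpa only [map_smul, RingHom.id_apply] using (hΦ X).const_smul c

theorem IsCPTP.of_tendsto {ι : Type*} {l : Filter ι} [l.NeBot] {F : ι → SuperOp H}
    {E : SuperOp H} (hF : ∀ n, IsCPTP (F n)) (h : ∀ X, Tendsto (fun n => F n X) l (𝓝 (E X))) :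
    IsCPTP E := by
  rw [isCPTP_iff]
  refine ⟨IsCP.of_tendsto (fun n => (hF n).isCP) h, fun X => ?_⟩
  have h1 := ((LinearMap.continuous_of_finiteDimensional (tr (H := H))).tendsto _).comp (h X)
  refine tendsto_nhds_unique h1 ?_
  refine tendsto_const_nhds.congr fun n => ?_
  exact ((hF n).2 X).symm

theorem IsCP.smul {E : SuperOp H} (hE : IsCP E) {c : ℝ} (hc : 0 ≤ c) : IsCP ((c : ℂ) • E) := by
  have : ((c : ℂ) • E : SuperOp H) = conjBy ((Real.sqrt c : ℂ) • (1 : Op H)) ∘ₗ E := by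
    ext1 X
    rw [LinearMap.comp_apply, conjBy_apply, ← ContinuousLinearMap.star_eq_adjoint, star_smul,
      star_one]
    change _ = (star (Real.sqrt c : ℂ) • (1 : Op H)) * (E X * ((Real.sqrt c : ℂ) • (1 : Op H)))
    rw [mul_smul_comm, mul_one, smul_mul_smul_comm, one_mul]
    simp only [RCLike.star_def, Complex.conj_ofReal]
    rw [← Complex.ofReal_mul, Real.mul_self_sqrt hc]
    rfl
  rw [this]
  exact (isCP_conjBy _).comp hE

/-- The Cesàro means of the powers of `E`. -/
noncomputable def cesaro (E : SuperOp H) (n : ℕ) : SuperOp H :=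
  (((n + 1 : ℝ)⁻¹ : ℝ) : ℂ) • ∑ k ∈ Finset.range (n + 1), E ^ k

theorem cesaro_apply (E : SuperOp H) (n : ℕ) (X : Op H) :
    cesaro E n X = (((n + 1 : ℝ)⁻¹ : ℝ) : ℂ) • ∑ k ∈ Finset.range (n + 1), (E ^ k) X := by
  rw [cesaro, LinearMap.smul_apply, LinearMap.sum_apply]

theorem cesaro_smul_const (n : ℕ) {M : Type*} [AddCommGroup M] [Module ℂ M] (m : M) :
    (((n + 1 : ℝ)⁻¹ : ℝ) : ℂ) • ∑ _k ∈ Finset.range (n + 1), m = m := by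
  rw [Finset.sum_const, Finset.card_range, ← Nat.cast_smul_eq_nsmul ℂ, smul_smul]
  have : (((n + 1 : ℝ)⁻¹ : ℝ) : ℂ) * ((n + 1 : ℕ) : ℂ) = 1 := by
    push_cast
    exact inv_mul_cancel₀ (Nat.cast_add_one_ne_zero n)
  rw [this, one_smul]

theorem isCPTP_cesaro {E : SuperOp H} (hE : IsCPTP E) (n : ℕ) : IsCPTP (cesaro E n) := by
  rw [isCPTP_iff]
  refine ⟨(IsCP.sum _ fun k _ => (hE.pow k).isCP).smul (by positivity), fun X => ?_⟩
  rw [cesaro_apply, map_smul, map_sum, Finset.sum_congr rfl fun k _ => (hE.pow k).2 X,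
    cesaro_smul_const]

theorem map_cesaro_sub (E : SuperOp H) (n : ℕ) (X : Op H) :
    E (cesaro E n X) - cesaro E n X = (((n + 1 : ℝ)⁻¹ : ℝ) : ℂ) • ((E ^ (n + 1)) X - X) := by
  rw [cesaro_apply, map_smul, ← smul_sub, map_sum]
  congr 1
  have h : ∀ k, E ((E ^ k) X) = (E ^ (k + 1)) X := fun k => by rw [pow_succ']; rfl
  rw [Finset.sum_congr rfl fun k _ => h k, ← Finset.sum_sub_distrib,
    Finset.sum_range_sub fun k => (E ^ k) X]
  rfl

theorem mem_fix {E : SuperOp H} {X : Op H} : X ∈ fix E ↔ E X = X := Iff.rfl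

theorem IsCPTPProjectionOnto.of_apply {E : SuperOp H} {A : Submodule ℂ (Op H)} (hE : IsCPTP E)
    (h1 : ∀ X, E X ∈ A) (h2 : ∀ X ∈ A, E X = X) : IsCPTPProjectionOnto E A := by
  refine ⟨hE, LinearMap.ext fun X => h2 _ (h1 X), le_antisymm ?_ fun X hX => ⟨X, h2 X hX⟩⟩
  rintro _ ⟨X, rfl⟩
  exact h1 X

theorem IsCPTPProjectionOnto.apply_mem {E : SuperOp H} {A : Submodule ℂ (Op H)}
    (hE : IsCPTPProjectionOnto E A) (X : Op H) : E X ∈ A :=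
  hE.2.2 ▸ LinearMap.mem_range_self E X

theorem IsCPTPProjectionOnto.apply_eq {E : SuperOp H} {A : Submodule ℂ (Op H)}
    (hE : IsCPTPProjectionOnto E A) {X : Op H} (hX : X ∈ A) : E X = X := by
  rw [← hE.2.2] at hX
  obtain ⟨Y, rfl⟩ := hX
  exact LinearMap.congr_fun hE.2.1 Y

/-- Mean ergodic argument: bounded Cesàro means converge along an ultrafilter, and telescoping shows
that the limit is fixed by `E`. -/
theorem IsCPTP.exists_projection {E : SuperOp H} (hE : IsCPTP E) :
    ∃ Φ : SuperOp H, IsCPTPProjectionOnto Φ (fix E) := by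
  have hl : ((hyperfilter ℕ : Ultrafilter ℕ) : Filter ℕ) ≤ atTop :=
    Nat.hyperfilter_le_atTop
  obtain ⟨Φ, hΦ⟩ := exists_linearMap_tendsto (l := (hyperfilter ℕ : Filter ℕ))
    (cesaro E) fun X => by
      have hc := isCompact_closedBall (0 : Op H) (4 * Module.finrank ℂ H * ‖X‖)
      obtain ⟨Y, -, hY⟩ := hc.ultrafilter_le_nhds
        ((hyperfilter ℕ).map fun n => cesaro E n X) <| by
          rw [le_principal_iff, Ultrafilter.coe_map, mem_map]
          refine Filter.univ_mem' fun n => ?_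
          simpa using (isCPTP_cesaro hE n).norm_apply_le X
      exact ⟨Y, hY⟩
  refine ⟨Φ, .of_apply (IsCPTP.of_tendsto (isCPTP_cesaro hE) hΦ) (fun X => ?_) fun X hX => ?_⟩
  · rw [mem_fix, ← sub_eq_zero]
    have h1 := ((LinearMap.continuous_of_finiteDimensional E).tendsto _).comp (hΦ X) |>.sub (hΦ X)
    refine tendsto_nhds_unique h1 ?_
    change Tendsto (fun n => E (cesaro E n X) - cesaro E n X)
      _ _
    simp only [map_cesaro_sub]
    refine Tendsto.mono_left ?_ hl
    have h2 : Tendsto (fun n : ℕ => (n + 1 : ℝ)⁻¹ * (4 * Module.finrank ℂ H * ‖X‖ + ‖X‖)) atTop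
        (𝓝 0) := by
      simpa using (tendsto_one_div_add_atTop_nhds_zero_nat (𝕜 := ℝ)).mul_const _
    refine squeeze_zero_norm (fun n => ?_) h2
    rw [norm_smul, Complex.norm_real, Real.norm_of_nonneg (by positivity)]
    gcongr
    exact (norm_sub_le _ _).trans (by gcongr; exact (hE.pow _).norm_apply_le X)
  · refine tendsto_nhds_unique (hΦ X) (tendsto_const_nhds.congr fun n => ?_)
    have h : ∀ k, (E ^ k) X = X := fun k => by
      induction k with
      | zero => rfl
      | succ k ih => rw [pow_succ]; exact (congrArg (E ^ k) hX).trans ih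
    rw [cesaro_apply, Finset.sum_congr rfl fun k _ => h k, cesaro_smul_const]

theorem range_mem_supp {A : Submodule ℂ (Op H)} (hstar : ∀ X ∈ A, star X ∈ A) {X : Op H}
    (hX : X ∈ A) (v : H) : X v ∈ supp A := by
  refine (le_iSup₂_of_le (star X) (hstar X hX) le_rfl :
    (LinearMap.ker (star X).toLinearMap)ᗮ ≤ supp A) ?_
  rw [Submodule.mem_orthogonal]
  intro w hw
  rw [← inner_star_left]
  have : star X w = 0 := hw
  rw [this, inner_zero_left]

theorem supp_starProjection_mul {A : Submodule ℂ (Op H)} (hstar : ∀ X ∈ A, star X ∈ A) {X : Op H}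
    (hX : X ∈ A) : (supp A).starProjection * X = X :=
  starProjection_mul_eq_self_iff.2 (range_mem_supp hstar hX)

theorem mul_supp_starProjection {A : Submodule ℂ (Op H)} (hstar : ∀ X ∈ A, star X ∈ A) {X : Op H}
    (hX : X ∈ A) : X * (supp A).starProjection = X := by
  rw [← star_inj, star_mul, star_starProjection, supp_starProjection_mul hstar (hstar X hX)]

theorem restrictTo_eq_self {K : Submodule ℂ H} {X : Op H} (h1 : K.starProjection * X = X)
    (h2 : X * K.starProjection = X) : restrictTo K X = X := by
  rw [restrictTo_apply, h1, h2, starProjection_orthogonal_eq, sub_mul, h1, one_mul, sub_self,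
    map_zero, zero_div, zero_smul, add_zero]

theorem starProjection_mul_restrictTo (K : Submodule ℂ H) (X : Op H) :
    K.starProjection * restrictTo K X = restrictTo K X := by
  rw [restrictTo_apply, mul_add, mul_smul_comm, ← mul_assoc, ← mul_assoc, starProjection_mul_self]

theorem restrictTo_mul_starProjection (K : Submodule ℂ H) (X : Op H) :
    restrictTo K X * K.starProjection = restrictTo K X := by
  rw [restrictTo_apply, add_mul, smul_mul_assoc, mul_assoc, starProjection_mul_self]

theorem fix_star_mem {E : SuperOp H} (hE : IsCPTP E) : ∀ X ∈ fix E, star X ∈ fix E := by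
  intro X hX
  rw [mem_fix] at *
  rw [hE.isCP.map_star, hX]

/-- The data from which the stabilizing projection onto a CPTP fixed-point set is built. -/
theorem exists_split_projection {A : Submodule ℂ (Op H)} (hA : IsCPTPFixedPointSet A)
    (hne : supp A ≠ ⊥) : ∃ (Φ : SuperOp H) (G : SuperOp (supp A)),
      IsCPTPProjectionOnto Φ A ∧ IsCPTPProjectionOnto G (A.comap (extend (supp A))) ∧
      sumId (supp A) G ∘ₗ restrictTo (supp A) = Φ ∘ₗ restrictTo (supp A) ∧
      IsCPTPProjectionOnto (Φ ∘ₗ restrictTo (supp A)) A := by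
  obtain ⟨E, hE, rfl⟩ := hA
  obtain ⟨Φ, hΦ⟩ := hE.exists_projection
  have hstar := fix_star_mem hE
  set K := supp (fix E) with hK
  have hl {X : Op H} (hX : X ∈ fix E) : K.starProjection * X = X := supp_starProjection_mul hstar hX
  have hr {X : Op H} (hX : X ∈ fix E) : X * K.starProjection = X := mul_supp_starProjection hstar hX
  have hec {X : Op H} (hX : X ∈ fix E) : extend K (compress K X) = X := by
    rw [extend_compress, hl hX, hr hX]
  -- The range of `Φ` lives on `K`, so compressing it to `K` loses nothing, in particular no trace.
  refine ⟨Φ, compress K ∘ₗ Φ ∘ₗ extend K, hΦ, .of_apply (isCPTP_iff.2 ⟨?_, fun Y => ?_⟩)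
    (fun Y => ?_) (fun Y hY => ?_), ?_, .of_apply (hΦ.1.comp (isCPTP_restrictTo hne))
    (fun X => hΦ.apply_mem _) fun X hX => ?_⟩
  · rw [compress_eq_conjBy, extend_eq_conjBy]
    exact (isCP_conjBy _).comp (hΦ.1.isCP.comp (isCP_conjBy _))
  · rw [LinearMap.comp_apply, LinearMap.comp_apply, ← tr_extend, hec (hΦ.apply_mem _), hΦ.1.2,
      tr_extend]
  · rw [Submodule.mem_comap, LinearMap.comp_apply, LinearMap.comp_apply, hec (hΦ.apply_mem _)]
    exact hΦ.apply_mem _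
  · rw [LinearMap.comp_apply, LinearMap.comp_apply, hΦ.apply_eq hY, compress_extend]
  · ext1 X
    set Y := restrictTo K X with hY
    have hY1 : extend K (compress K Y) = Y := by
      rw [extend_compress, starProjection_mul_restrictTo, restrictTo_mul_starProjection]
    have hY2 : extend Kᗮ (compress Kᗮ Y) = 0 := by
      rw [extend_compress, starProjection_orthogonal_eq, sub_mul, starProjection_mul_restrictTo,
        one_mul, sub_self, zero_mul]
    change extend K (compress K (Φ (extend K (compress K Y)))) + extend Kᗮ (compress Kᗮ Y) = Φ Y
    rw [hY2, add_zero, hY1, hec (hΦ.apply_mem _)]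
  · rw [LinearMap.comp_apply, restrictTo_eq_self (hl hX) (hr hX), hΦ.apply_eq hX]

end Channels

/-! ### Supports and faithful positive elements -/

section Support

variable {H : Type*} [NormedAddCommGroup H] [InnerProductSpace ℂ H]
  [FiniteDimensional ℂ H] [CompleteSpace H]

theorem mul_starProjection_ker (X : Op H) :
    X * (LinearMap.ker X.toLinearMap).starProjection = 0 := by
  ext v
  exact Submodule.starProjection_apply_mem (LinearMap.ker X.toLinearMap) v

theorem starProjection_ker_mul {X : Op H} (hX : IsSelfAdjoint X) :
    (LinearMap.ker X.toLinearMap).starProjection * X = 0 := by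
  rw [← star_inj, star_mul, star_starProjection, hX.star_eq, mul_starProjection_ker, star_zero]

theorem mul_starProjection_eq_zero_iff {X : Op H} {K : Submodule ℂ H} :
    X * K.starProjection = 0 ↔ K ≤ LinearMap.ker X.toLinearMap := by
  constructor
  · intro h v hv
    have : X (K.starProjection v) = 0 := DFunLike.congr_fun h v
    rwa [Submodule.starProjection_eq_self_iff.2 hv] at this
  · intro h
    ext v
    exact h (Submodule.starProjection_apply_mem K v)

theorem le_ker_of_tr {X : Op H} (hX : 0 ≤ X) {K : Submodule ℂ H}
    (h : (tr (K.starProjection * X)).re = 0) : K ≤ LinearMap.ker X.toLinearMap := by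
  rw [← mul_starProjection_eq_zero_iff, ← star_inj, star_mul, star_starProjection,
    hX.isSelfAdjoint.star_eq, star_zero]
  exact mul_eq_zero_of_tr_mul (starProjection_nonneg K) hX h

theorem inner_eq_zero_iff_mem_ker {X : Op H} (hX : 0 ≤ X) {v : H} :
    inner ℂ v (X v) = 0 ↔ X v = 0 := by
  refine ⟨fun h => ?_, fun h => by rw [h, inner_zero_right]⟩
  obtain ⟨a, rfl⟩ := nonneg_iff_exists_star_mul_self.1 hX
  have h1 : inner ℂ (a v) (a v) = 0 := (inner_star_right a v (a v)).symm.trans h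
  have h2 : a v = 0 := inner_self_eq_zero.1 h1
  change star a (a v) = 0
  rw [h2, map_zero]

theorem ker_add_le {X Y : Op H} (hX : 0 ≤ X) (hY : 0 ≤ Y) :
    LinearMap.ker (X + Y).toLinearMap ≤
      LinearMap.ker X.toLinearMap ⊓ LinearMap.ker Y.toLinearMap := by
  intro v hv
  have hv : X v + Y v = 0 := hv
  have h := congrArg (inner ℂ v) hv
  rw [inner_add_right, inner_zero_right] at h
  have h1 := nonneg_iff_inner.1 hX v
  have h2 := nonneg_iff_inner.1 hY v
  have h3 := (add_eq_zero_iff_of_nonneg h1 h2).1 h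
  exact ⟨(inner_eq_zero_iff_mem_ker hX).1 h3.1, (inner_eq_zero_iff_mem_ker hY).1 h3.2⟩

/-- A set of operators closed under adjoints and under taking positive parts. -/
structure IsPosPartClosed (A : Submodule ℂ (Op H)) : Prop where
  star_mem : ∀ X ∈ A, star X ∈ A
  left_mem : ∀ a b : Op H, 0 ≤ a → 0 ≤ b → a * b = 0 → a - b ∈ A → a ∈ A

/-- This stability is why the property is isolated: that the intersection is itself the range of a
channel is known only after the limit has been constructed. -/
theorem IsPosPartClosed.iInf {ι : Sort*} {A : ι → Submodule ℂ (Op H)}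
    (hA : ∀ i, IsPosPartClosed (A i)) : IsPosPartClosed (⨅ i, A i) := by
  constructor <;> simp only [Submodule.mem_iInf]
  · exact fun X hX i => (hA i).star_mem X (hX i)
  · exact fun a b ha hb hab h i => (hA i).left_mem a b ha hb hab (h i)

/-- With `q` the projection onto `ker a`, trace preservation gives `tr (q E a) + tr ((1 - q) E b) =
0`. Both terms are nonnegative, so both products vanish and `E a = (1 - q) E a = a`. -/
theorem IsPosPartClosed.fix {E : SuperOp H} (hE : IsCPTP E) : IsPosPartClosed (fix E) := by
  refine ⟨fix_star_mem hE, fun a b ha hb hab h => ?_⟩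
  rw [mem_fix, map_sub] at h
  rw [mem_fix]
  set q := (LinearMap.ker a.toLinearMap).starProjection with hq
  have hqa : q * a = 0 := starProjection_ker_mul ha.isSelfAdjoint
  have hqb : q * b = b := starProjection_mul_eq_self_iff.2 fun v => DFunLike.congr_fun hab v
  have hEa := hE.map_nonneg a ha
  have hEb := hE.map_nonneg b hb
  have hp : 0 ≤ 1 - q := sub_nonneg.2 (starProjection_le_one _)
  have h1 := tr_mul_re_nonneg (starProjection_nonneg (LinearMap.ker a.toLinearMap)) hEa
  have h2 := tr_mul_re_nonneg hp hEb
  have hpEa : (1 - q) * E a = a + (1 - q) * E b := by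
    have : E a = a - b + E b := by rw [← h]; abel
    rw [this, mul_add, mul_sub, sub_mul, sub_mul, hqa, hqb, one_mul, one_mul]
    abel
  have h3 : tr (q * E a) + tr ((1 - q) * E b) = 0 := by
    have h4 : tr (q * E a) + tr ((1 - q) * E a) = tr a := by
      rw [← map_add, ← add_mul, add_sub_cancel, one_mul, hE.2]
    rw [hpEa, map_add] at h4
    linear_combination h4
  have h5 := congrArg Complex.re h3
  rw [Complex.add_re, Complex.zero_re] at h5
  have h6 : q * E a = 0 :=
    mul_eq_zero_of_tr_mul (starProjection_nonneg _) hEa (by rw [← hq] at *; linarith)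
  have h7 : (1 - q) * E b = 0 := mul_eq_zero_of_tr_mul hp hEb (by rw [← hq] at *; linarith)
  rw [h7, add_zero, sub_mul, h6, one_mul, sub_zero] at hpEa
  exact hpEa

theorem IsPosPartClosed.ker_le {A : Submodule ℂ (Op H)} (hA : IsPosPartClosed A)
    {N : Submodule ℂ H} (hN : ∀ X ∈ A, 0 ≤ X → N ≤ LinearMap.ker X.toLinearMap)
    {X : Op H} (hX : X ∈ A) : N ≤ LinearMap.ker X.toLinearMap := by
  have hsa (Y : Op H) (hY : IsSelfAdjoint Y) (hYA : Y ∈ A) : N ≤ LinearMap.ker Y.toLinearMap := by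
    have hsub : Y⁺ - Y⁻ = Y := CFC.posPart_sub_negPart Y hY
    have h1 : Y⁺ ∈ A := hA.left_mem _ _ (CFC.posPart_nonneg Y) (CFC.negPart_nonneg Y)
      (CFC.posPart_mul_negPart Y) (by rwa [hsub])
    have h2 : Y⁻ ∈ A := by
      have := A.sub_mem h1 hYA
      rwa [show Y⁺ - Y = Y⁻ by nth_rw 2 [← hsub]; rw [sub_sub_cancel]] at this
    intro v hv
    have e1 : Y⁺ v = 0 := hN _ h1 (CFC.posPart_nonneg Y) hv
    have e2 : Y⁻ v = 0 := hN _ h2 (CFC.negPart_nonneg Y) hv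
    change Y v = 0
    rw [← hsub]
    change Y⁺ v - Y⁻ v = 0
    rw [e1, e2, sub_zero]
  have hs := hA.star_mem X hX
  have h1 := hsa (X + star X) (IsSelfAdjoint.add_star_self X) (A.add_mem hX hs)
  have h2 := hsa (Complex.I • (X - star X)) (by
    rw [isSelfAdjoint_iff, star_smul, star_sub, star_star, RCLike.star_def, Complex.conj_I, neg_smul,
      ← smul_neg, neg_sub]) (A.smul_mem _ (A.sub_mem hX hs))
  intro v hv
  have e1 : X v + star X v = 0 := h1 hv
  have e2 : Complex.I • (X v - star X v) = 0 := h2 hv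
  have e3 : X v - star X v = 0 := (smul_eq_zero.1 e2).resolve_left Complex.I_ne_zero
  have e4 : (2 : ℂ) • X v = 0 := by
    rw [two_smul]
    calc X v + X v = (X v + star X v) + (X v - star X v) := by abel
      _ = 0 := by rw [e1, e3, add_zero]
  exact (smul_eq_zero.1 e4).resolve_left two_ne_zero

/-- Take a positive `σ` in `A` with kernel of least dimension. Adding a positive `Y` cannot shrink
that kernel, so `ker σ ≤ ker Y`; by `ker_le` the same holds for all of `A`. -/
theorem IsPosPartClosed.exists_ker_eq {A : Submodule ℂ (Op H)} (hA : IsPosPartClosed A) :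
    ∃ σ ∈ A, 0 ≤ σ ∧ LinearMap.ker σ.toLinearMap = (supp A)ᗮ := by
  obtain ⟨σ, ⟨hσA, hσ⟩, hmin⟩ := WellFounded.has_min
    (InvImage.wf (fun X : Op H => Module.finrank ℂ (LinearMap.ker X.toLinearMap)) wellFounded_lt)
    {X : Op H | X ∈ A ∧ 0 ≤ X} ⟨0, A.zero_mem, le_rfl⟩
  have h1 (Y : Op H) (hYA : Y ∈ A) (hY : 0 ≤ Y) :
      LinearMap.ker σ.toLinearMap ≤ LinearMap.ker Y.toLinearMap := by
    have hle := ker_add_le hσ hY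
    have h2 := hmin (σ + Y) ⟨A.add_mem hσA hYA, add_nonneg hσ hY⟩
    have h3 := Submodule.eq_of_le_of_finrank_le (hle.trans inf_le_left) (not_lt.1 h2)
    rw [← h3]
    exact hle.trans inf_le_right
  refine ⟨σ, hσA, hσ, ?_⟩
  have : supp A = (LinearMap.ker σ.toLinearMap)ᗮ :=
    le_antisymm (iSup₂_le fun X hX => Submodule.orthogonal_le (hA.ker_le h1 hX))
      (le_iSup₂_of_le σ hσA le_rfl)
  rw [this, Submodule.orthogonal_orthogonal]

end Support

/-! ### The two Lyapunov functions -/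

section Lyapunov

variable {H : Type*} [NormedAddCommGroup H] [InnerProductSpace ℂ H]
  [FiniteDimensional ℂ H] [CompleteSpace H]

theorem IsCPTP.tr_ker_mul_le {E : SuperOp H} (hE : IsCPTP E) {σ : Op H} (hσ : 0 ≤ σ)
    (hfix : E σ = σ) {N : Submodule ℂ H} (hN : LinearMap.ker σ.toLinearMap = N)
    {X : Op H} (hX : 0 ≤ X) :
    (tr (N.starProjection * E X)).re ≤ (tr (N.starProjection * X)).re := by
  subst hN
  obtain ⟨D, hD, h⟩ := exists_dual_ker hE.map_nonneg hE.2 hσ hfix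
  have := tr_mul_re_nonneg (sub_nonneg.2 hD) hX
  rw [sub_mul, map_sub, h, Complex.sub_re] at this
  linarith

/-- Let `q` project onto `ker (E X)` and let `D ≤ q` be its dual. Invariance of `ρ` gives `tr ((q -
D) ρ) = 0`, so `q - D` maps into `ker ρ`, hence into `ker X`. Then `tr (q X) = tr (D X) = tr (q E X)
= 0`. -/
theorem IsCPTP.ker_apply_le {E : SuperOp H} (hE : IsCPTP E) {ρ : Op H} (hρ : 0 ≤ ρ)
    (hfix : E ρ = ρ) {X : Op H} (hX : 0 ≤ X) (hEX : E (E X) = E X)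
    (hker : LinearMap.ker ρ.toLinearMap ≤ LinearMap.ker X.toLinearMap) :
    LinearMap.ker (E X).toLinearMap ≤ LinearMap.ker X.toLinearMap := by
  have hσ := hE.map_nonneg X hX
  obtain ⟨D, hD, h⟩ := exists_dual_ker hE.map_nonneg hE.2 hσ hEX
  refine le_ker_of_tr hX ?_
  set q := (LinearMap.ker (E X).toLinearMap).starProjection with hq
  have hqD := sub_nonneg.2 hD
  have h1 : (q - D) * ρ = 0 := by
    refine mul_eq_zero_of_tr_mul hqD hρ ?_
    rw [sub_mul, map_sub, h, hfix, sub_self]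
    rfl
  have h2 : ρ * (q - D) = 0 := by
    rw [← star_inj, star_mul, hqD.isSelfAdjoint.star_eq, hρ.isSelfAdjoint.star_eq, h1, star_zero]
  have h3 : X * (q - D) = 0 := by
    ext v
    exact hker (DFunLike.congr_fun h2 v : ρ ((q - D) v) = 0)
  have h4 : tr ((q - D) * X) = 0 := by rw [tr_mul_comm, h3, map_zero]
  rw [sub_mul, map_sub, h, starProjection_ker_mul hσ.isSelfAdjoint, map_zero, sub_zero] at h4
  rw [h4]
  rfl

theorem starProjection_mul_of_le {L K : Submodule ℂ H} (h : L ≤ K) :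
    K.starProjection * L.starProjection = L.starProjection :=
  starProjection_mul_eq_self_iff.2 fun v => h (Submodule.starProjection_apply_mem L v)

theorem mul_starProjection_of_le {L K : Submodule ℂ H} (h : L ≤ K) :
    L.starProjection * K.starProjection = L.starProjection := by
  rw [← star_inj, star_mul, star_starProjection, star_starProjection, starProjection_mul_of_le h]

/-- The weight outside `K` is spread evenly over `K`, and the share `tr P_L / tr P_K` of it falls
inside `L`. -/
theorem tr_orthogonal_mul_restrictTo {L K : Submodule ℂ H} (h : L ≤ K) (hK : K ≠ ⊥) (X : Op H) :
    tr (Lᗮ.starProjection * restrictTo K X) = tr (Lᗮ.starProjection * X) -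
      tr (Kᗮ.starProjection * X) / tr K.starProjection * tr L.starProjection := by
  have hK' := tr_starProjection_ne_zero hK
  set c := tr (Kᗮ.starProjection * X) / tr K.starProjection with hc
  have hc' : tr (Kᗮ.starProjection * X) = c * tr K.starProjection := by
    rw [hc, div_mul_cancel₀ _ hK']
  have h1 : tr (L.starProjection * (K.starProjection * X * K.starProjection)) =
      tr (L.starProjection * X) := by
    rw [tr_mul_comm, mul_assoc, tr_mul_comm, starProjection_mul_of_le h, ← mul_assoc,
      mul_starProjection_of_le h]
  rw [starProjection_orthogonal_eq, sub_mul, one_mul, map_sub] at hc'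
  rw [starProjection_orthogonal_eq, restrictTo_apply, ← hc, sub_mul, sub_mul, one_mul, one_mul,
    mul_add, map_sub, map_sub, map_add, map_add, mul_smul_comm, mul_starProjection_of_le h, h1,
    tr_starProjection_conj, map_smul, map_smul, smul_eq_mul, smul_eq_mul]
  linear_combination -hc'

/-- One stabilizing projection never increases the weight outside `L`; if it keeps that weight,
then it acts inside `K` and enlarges supports. -/
theorem restrict_project_step {A : Submodule ℂ (Op H)} {Φ : SuperOp H}
    (hΦ : IsCPTPProjectionOnto Φ A) {K L : Submodule ℂ H} (hL : L ≠ ⊥) (hLK : L ≤ K)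
    {ρ σ : Op H} (hρA : ρ ∈ A) (hρ : 0 ≤ ρ) (hρK : LinearMap.ker ρ.toLinearMap = Kᗮ)
    (hσA : σ ∈ A) (hσ : 0 ≤ σ) (hσL : LinearMap.ker σ.toLinearMap = Lᗮ)
    {X : Op H} (hX : 0 ≤ X) :
    (tr (Lᗮ.starProjection * Φ (restrictTo K X))).re ≤ (tr (Lᗮ.starProjection * X)).re ∧
    ((tr (Lᗮ.starProjection * X)).re ≤ (tr (Lᗮ.starProjection * Φ (restrictTo K X))).re →
      Kᗮ ≤ LinearMap.ker X.toLinearMap ∧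
      LinearMap.ker (Φ (restrictTo K X)).toLinearMap ≤ LinearMap.ker X.toLinearMap) := by
  have hK : K ≠ ⊥ := fun h => hL (le_bot_iff.1 (h ▸ hLK))
  have h1 := hΦ.1.tr_ker_mul_le hσ (hΦ.apply_eq hσA) hσL
    ((isCPTP_restrictTo hK).map_nonneg X hX)
  have hLpos : 0 < (tr L.starProjection).re :=
    lt_of_le_of_ne (tr_re_nonneg (starProjection_nonneg L)) fun h =>
      tr_starProjection_ne_zero hL <| by
        rw [tr_eq_ofReal (starProjection_nonneg L), ← h, Complex.ofReal_zero]
  have hKpos : 0 < (tr K.starProjection).re :=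
    lt_of_le_of_ne (tr_re_nonneg (starProjection_nonneg K)) fun h =>
      tr_starProjection_ne_zero hK <| by
        rw [tr_eq_ofReal (starProjection_nonneg K), ← h, Complex.ofReal_zero]
  have h2 := congrArg Complex.re (tr_orthogonal_mul_restrictTo hLK hK X)
  rw [tr_eq_ofReal (starProjection_nonneg K), tr_eq_ofReal (starProjection_nonneg L),
    Complex.sub_re, Complex.re_mul_ofReal, Complex.div_ofReal_re] at h2
  have h3 := tr_mul_re_nonneg (starProjection_nonneg Kᗮ) hX
  have h4 : 0 ≤ (tr (Kᗮ.starProjection * X)).re / (tr K.starProjection).re *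
    (tr L.starProjection).re := by positivity
  refine ⟨by linarith, fun h => ?_⟩
  -- Equality leaves no room for a transfer into `L ≠ ⊥`, so `X` had no weight outside `K`.
  have h5 : (tr (Kᗮ.starProjection * X)).re / (tr K.starProjection).re *
    (tr L.starProjection).re = 0 := by linarith
  have h6 : (tr (Kᗮ.starProjection * X)).re = 0 := by
    rcases mul_eq_zero.1 h5 with h6 | h6
    · exact (div_eq_zero_iff.1 h6).resolve_right hKpos.ne'
    · exact absurd h6 hLpos.ne'
  have h7 := le_ker_of_tr hX h6
  refine ⟨h7, ?_⟩
  have hXK : X * K.starProjection = X := by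
    have := mul_starProjection_eq_zero_iff.2 h7
    rw [starProjection_orthogonal_eq, mul_sub, mul_one, sub_eq_zero] at this
    exact this.symm
  have hKX : K.starProjection * X = X := by
    rw [← star_inj, star_mul, star_starProjection, hX.isSelfAdjoint.star_eq, hXK]
  rw [restrictTo_eq_self hKX hXK]
  exact hΦ.1.ker_apply_le hρ (hΦ.apply_eq hρA) hX (hΦ.apply_eq (hΦ.apply_mem X)) (hρK ▸ h7)

/-- The squared Hilbert–Schmidt norm. -/
noncomputable def hsSq (Z : Op H) : ℝ := (tr (star Z * Z)).re

theorem hsSq_nonneg (Z : Op H) : 0 ≤ hsSq Z := tr_re_nonneg (star_mul_self_nonneg Z)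

theorem hsSq_parallelogram (Y Z : Op H) :
    hsSq (Y + Z) + hsSq (Y - Z) = 2 * (hsSq Y + hsSq Z) := by
  simp only [hsSq, star_add, star_sub, mul_add, mul_sub, add_mul, sub_mul, map_add, map_sub,
    Complex.add_re, Complex.sub_re]
  ring

theorem hsSq_smul (c : ℝ) (Z : Op H) : hsSq ((c : ℂ) • Z) = c ^ 2 * hsSq Z := by
  rw [hsSq, star_smul, smul_mul_smul_comm, map_smul, RCLike.star_def, Complex.conj_ofReal,
    ← Complex.ofReal_mul, smul_eq_mul, Complex.re_ofReal_mul, sq]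
  rfl

theorem exists_sqrt_inverse {σ : Op H} (hσ : 0 ≤ σ) {L : Submodule ℂ H}
    (hker : LinearMap.ker σ.toLinearMap = Lᗮ) :
    ∃ s J : Op H, star s = s ∧ s * s = σ ∧ J * s = L.starProjection ∧ s * J = L.starProjection := by
  obtain ⟨s, hs, hss⟩ := CStarAlgebra.nonneg_iff_exists_nonneg_and_eq_mul_self.1 hσ
  have hstar : star s = s := hs.isSelfAdjoint.star_eq
  have hsker : LinearMap.ker s.toLinearMap = Lᗮ := by
    rw [← hker]
    ext v
    constructor
    · intro hv
      have hv : s v = 0 := hv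
      change σ v = 0
      rw [hss]
      change s (s v) = 0
      rw [hv, map_zero]
    · intro hv
      have hv : σ v = 0 := hv
      have h1 : inner ℂ (s v) (s v) = 0 := by
        rw [← inner_star_right, hstar]
        change inner ℂ v ((s * s) v) = 0
        rw [← hss, hv, inner_zero_right]
      exact inner_self_eq_zero.1 h1
  have hsQ : s * Lᗮ.starProjection = 0 := mul_starProjection_eq_zero_iff.2 hsker.ge
  have hQs : Lᗮ.starProjection * s = 0 := by
    rw [← star_inj, star_mul, star_starProjection, hstar, hsQ, star_zero]
  have hsP : s * L.starProjection = s := by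
    rw [starProjection_orthogonal_eq, mul_sub, mul_one, sub_eq_zero] at hsQ
    exact hsQ.symm
  have hPs : L.starProjection * s = s := by
    rw [← star_inj, star_mul, star_starProjection, hstar, hsP]
  have hPQ : L.starProjection * Lᗮ.starProjection = 0 := by
    rw [starProjection_orthogonal_eq, mul_sub, mul_one, starProjection_mul_self, sub_self]
  have hQP : Lᗮ.starProjection * L.starProjection = 0 := by
    rw [starProjection_orthogonal_eq, sub_mul, one_mul, starProjection_mul_self, sub_self]
  -- Adding the projection onto `Lᗮ = ker s` makes `s` invertible; `J`, the inverse of `M`, acts as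
  -- `σ^{-1/2}` on `L`.
  set M : Op H := s + Lᗮ.starProjection with hM
  have hPM : L.starProjection * M = s := by rw [hM, mul_add, hPs, hPQ, add_zero]
  have hMP : M * L.starProjection = s := by rw [hM, add_mul, hsP, hQP, add_zero]
  have hQM : Lᗮ.starProjection * M = Lᗮ.starProjection := by
    rw [hM, mul_add, hQs, zero_add, starProjection_mul_self]
  have hinj : Function.Injective M.toLinearMap := by
    rw [← LinearMap.ker_eq_bot, eq_bot_iff]
    intro v hv
    have hv : M v = 0 := hv
    have h1 : s v = 0 := by
      rw [← hPM]
      change L.starProjection (M v) = 0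
      rw [hv, map_zero]
    have h2 : Lᗮ.starProjection v = 0 := by
      rw [← hQM]
      change Lᗮ.starProjection (M v) = 0
      rw [hv, map_zero]
    have h3 : v ∈ Lᗮ := by rw [← hsker]; exact h1
    rw [Submodule.starProjection_eq_self_iff.2 h3] at h2
    exact h2
  let e := LinearEquiv.ofInjectiveEndo M.toLinearMap hinj
  let J : Op H := LinearMap.toContinuousLinearMap e.symm.toLinearMap
  have hJM : J * M = 1 := by
    ext v
    exact e.symm_apply_apply v
  have hMJ : M * J = 1 := by
    ext v
    exact e.apply_symm_apply v
  refine ⟨s, J, hstar, hss.symm, ?_, ?_⟩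
  · rw [← hMP, ← mul_assoc, hJM, one_mul]
  · rw [← hPM, mul_assoc, hMJ, mul_one]

/-- An operator Schwarz inequality: with `y = s z`, `E y = s w` and `s²` fixed, 2-positivity yields
`star w * w ≤ E (star z * z)`; the trace of this is the claim. -/
theorem IsCPTP.hsSq_le {E : SuperOp H} (hE : IsCPTP E) {s J P y : Op H} (hs : star s = s)
    (hfix : E (s * s) = s * s) (hJs : J * s = P) (hsJ : s * J = P) (hy : P * y = y)
    (hEy : P * E y = E y) : hsSq (J * E y) ≤ hsSq (J * y) := by
  set z := J * y with hz
  set w := J * E y with hw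
  have hsz : s * z = y := by rw [hz, ← mul_assoc, hsJ, hy]
  have hsw : s * w = E y := by rw [hw, ← mul_assoc, hsJ, hEy]
  have hPw : P * w = w := by
    rw [← hJs, mul_assoc, hsw]
  set B := E (star z * z) with hB
  have hstar : E (star z * s) = star (s * w) := by
    rw [hsw, ← hE.isCP.map_star, ← hsz, star_mul s z, hs]
  have key (v : H) : ‖w v‖ ^ 2 ≤ (inner ℂ v (B v)).re := by
    -- The first test vector `u` solves `s u = -w v`, which minimizes the quadratic form in `u`.
    have h := hE.isCP.inner_nonneg s z (-(J (w v))) v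
    rw [hstar, hs, hfix, hsz, ← hsw, ← hB] at h
    have hsJw : s (J (w v)) = w v := by
      change (s * J * w) v = w v
      rw [hsJ, hPw]
    have e1 : inner ℂ (-(J (w v))) ((s * s) (-(J (w v)))) = inner ℂ (w v) (w v) := by
      change inner ℂ (-(J (w v))) (s (s (-(J (w v))))) = _
      rw [map_neg, map_neg, inner_neg_neg, ← inner_star_left, hs, hsJw]
    have e2 : inner ℂ (-(J (w v))) ((s * w) v) = - inner ℂ (w v) (w v) := by
      change inner ℂ (-(J (w v))) (s (w v)) = _
      rw [inner_neg_left, ← inner_star_left, hs, hsJw]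
    have e3 : inner ℂ v (star (s * w) (-(J (w v)))) = - inner ℂ (w v) (w v) := by
      rw [inner_star_right]
      change inner ℂ (s (w v)) (-(J (w v))) = _
      rw [inner_neg_right, ← inner_star_right, hs, hsJw]
    rw [e1, e2, e3, add_neg_cancel, zero_add] at h
    have h' := (Complex.nonneg_iff.1 h).1
    rw [Complex.add_re, Complex.neg_re] at h'
    have h'' : (inner ℂ (w v) (w v)).re = ‖w v‖ ^ 2 := inner_self_eq_norm_sq (𝕜 := ℂ) (w v)
    linarith
  let b := stdOrthonormalBasis ℂ H
  have h1 : hsSq w = ∑ i, ‖w (b i)‖ ^ 2 := by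
    rw [hsSq, tr_star_mul_self b, Complex.ofReal_re]
  have h2 : hsSq z = ∑ i, (inner ℂ (b i) (B (b i))).re := by
    rw [hsSq, ← hE.2, tr_eq_sum_inner b, Complex.re_sum]
  rw [h1, h2]
  exact Finset.sum_le_sum fun i _ => key (b i)

/-- Strict convexity: the midpoint of `y` and `E y` is also sent to `E y`, so by monotonicity its
norm is no smaller than that of `E y`, and the parallelogram law forces `J y = J (E y)`. -/
theorem IsCPTP.apply_eq_of_hsSq_le {E : SuperOp H} (hE : IsCPTP E) {s J P y : Op H}
    (hs : star s = s) (hfix : E (s * s) = s * s) (hJs : J * s = P) (hsJ : s * J = P)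
    (hy : P * y = y) (hEy : P * E y = E y) (hEE : E (E y) = E y)
    (h : hsSq (J * y) ≤ hsSq (J * E y)) : E y = y := by
  set m : Op H := ((1 / 2 : ℝ) : ℂ) • (y + E y) with hm
  have hEm : E m = E y := by
    rw [hm, map_smul, map_add, hEE, ← two_smul ℂ (E y), smul_smul]
    norm_num
  have h1 := hE.hsSq_le hs hfix hJs hsJ (y := m)
    (by rw [hm, mul_smul_comm, mul_add, hy, hEy]) (by rw [hEm, hEy])
  rw [hEm, hm, mul_smul_comm, hsSq_smul, mul_add] at h1
  have h2 := hsSq_parallelogram (J * y) (J * E y)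
  have h3 := hsSq_nonneg (J * y - J * E y)
  have h4 : hsSq (J * y - J * E y) = 0 := by linarith
  have h5 := eq_zero_of_tr_star_mul_self h4
  have h6 : s * (J * y - J * E y) = 0 := by rw [h5, mul_zero]
  rw [mul_sub, ← mul_assoc, ← mul_assoc, hsJ, hy, hEy, sub_eq_zero] at h6
  exact h6.symm

end Lyapunov

/-! ### Convergence of the iterated cycle -/

section Convergence

variable {H : Type*} [NormedAddCommGroup H] [InnerProductSpace ℂ H]
  [FiniteDimensional ℂ H] [CompleteSpace H] {ι : Type*}

/-- The composition of the maps `E i` for `i` in a list, the head being applied first. -/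
noncomputable def listComp (E : ι → SuperOp H) (l : List ι) : SuperOp H :=
  (l.map E).reverse.prod

theorem listComp_cons_apply (E : ι → SuperOp H) (i : ι) (l : List ι) (X : Op H) :
    listComp E (i :: l) X = listComp E l (E i X) := by
  rw [listComp, List.map_cons, List.reverse_cons, List.prod_append, List.prod_singleton]
  rfl

theorem cycle_eq_listComp {r : ℕ} (E : Fin r → SuperOp H) :
    cycle E = listComp E (List.finRange r) := by
  rw [cycle, List.ofFn_eq_map]
  rfl

theorem isCPTP_listComp {E : ι → SuperOp H} (hE : ∀ i, IsCPTP (E i)) (l : List ι) :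
    IsCPTP (listComp E l) := by
  induction l with
  | nil => exact isCPTP_id
  | cons i l ih =>
    have : listComp E (i :: l) = listComp E l ∘ₗ E i :=
      LinearMap.ext (listComp_cons_apply E i l)
    rw [this]
    exact ih.comp (hE i)

theorem listComp_apply_eq_self {E : ι → SuperOp H} {X : Op H} (hX : ∀ i, E i X = X) (l : List ι) :
    listComp E l X = X := by
  induction l with
  | nil => rfl
  | cons i l ih => rw [listComp_cons_apply, hX, ih]

/-- If the whole composition preserves `f`, so does every factor, and kernels decrease along the
list. Equal end kernels then make all intermediate ones equal, so the constraint of each factor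
refers back to `X`. -/
theorem listComp_weight_step {E : ι → SuperOp H} (hE : ∀ i, IsCPTP (E i)) {f : Op H → ℝ}
    {N : ι → Submodule ℂ H}
    (hf : ∀ i X, 0 ≤ X → f (E i X) ≤ f X ∧ (f X ≤ f (E i X) →
      N i ≤ LinearMap.ker X.toLinearMap ∧
      LinearMap.ker (E i X).toLinearMap ≤ LinearMap.ker X.toLinearMap))
    (l : List ι) {X : Op H} (hX : 0 ≤ X) :
    f (listComp E l X) ≤ f X ∧ (f X ≤ f (listComp E l X) →
      LinearMap.ker (listComp E l X).toLinearMap ≤ LinearMap.ker X.toLinearMap ∧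
      (LinearMap.ker X.toLinearMap ≤ LinearMap.ker (listComp E l X).toLinearMap →
        ∀ i ∈ l, N i ≤ LinearMap.ker X.toLinearMap)) := by
  induction l generalizing X with
  | nil => exact ⟨le_rfl, fun _ => ⟨le_rfl, fun _ i hi => absurd hi List.not_mem_nil⟩⟩
  | cons i l ih =>
    rw [listComp_cons_apply]
    obtain ⟨h1, h2⟩ := hf i X hX
    obtain ⟨h3, h4⟩ := ih ((hE i).map_nonneg X hX)
    refine ⟨h3.trans h1, fun h => ?_⟩
    obtain ⟨h5, h6⟩ := h2 (h.trans h3)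
    obtain ⟨h7, h8⟩ := h4 (h1.trans h)
    refine ⟨h7.trans h6, fun hk j hj => ?_⟩
    rcases List.mem_cons.1 hj with rfl | hj
    · exact h5
    · exact (h8 (h6.trans hk) j hj).trans h6

theorem listComp_hsSq_step {E : ι → SuperOp H} (hE : ∀ i, IsCPTP (E i))
    (hEE : ∀ i X, E i (E i X) = E i X) {s J P : Op H} (hs : star s = s)
    (hfix : ∀ i, E i (s * s) = s * s) (hJs : J * s = P) (hsJ : s * J = P)
    (hP : ∀ i X, 0 ≤ X → P * X = X → P * E i X = E i X)
    (l : List ι) {X : Op H} (hX : 0 ≤ X) (hPX : P * X = X) :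
    hsSq (J * listComp E l X) ≤ hsSq (J * X) ∧
      (hsSq (J * X) ≤ hsSq (J * listComp E l X) → ∀ i ∈ l, E i X = X) := by
  induction l generalizing X with
  | nil => exact ⟨le_rfl, fun _ i hi => absurd hi List.not_mem_nil⟩
  | cons i l ih =>
    rw [listComp_cons_apply]
    have hPE := hP i X hX hPX
    have h1 := (hE i).hsSq_le hs (hfix i) hJs hsJ hPX hPE
    obtain ⟨h3, h4⟩ := ih ((hE i).map_nonneg X hX) hPE
    refine ⟨h3.trans h1, fun h => ?_⟩
    have h5 : E i X = X :=
      (hE i).apply_eq_of_hsSq_le hs (hfix i) hJs hsJ hPX hPE (hEE i X) (h.trans h3)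
    intro j hj
    rcases List.mem_cons.1 hj with rfl | hj
    · exact h5
    · have := h4 (h1.trans h) j hj
      rwa [h5] at this

theorem IsCPTP.tendsto_of_mem_closure {T : SuperOp H} (hT : IsCPTP T) {τ y : Op H} (hy : T y = y)
    (hmem : y ∈ closure (Set.range fun n : ℕ => (T ^ n) τ)) :
    Tendsto (fun n : ℕ => (T ^ n) τ) atTop (𝓝 y) := by
  have hpow (n : ℕ) : (T ^ n) y = y := by
    induction n with
    | zero => rfl
    | succ n ih => rw [pow_succ]; exact (congrArg (T ^ n) hy).trans ih
  rw [Metric.tendsto_atTop]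
  intro ε hε
  set C : ℝ := 4 * Module.finrank ℂ H with hC
  have hC0 : 0 ≤ C := by positivity
  -- `C` bounds every power of `T`, so an orbit once this close to `y` stays within `ε`; `C + 1`
  -- avoids dividing by zero when `H` is trivial.
  obtain ⟨_, ⟨n, rfl⟩, hn⟩ := Metric.mem_closure_iff.1 hmem (ε / (C + 1)) (by positivity)
  refine ⟨n, fun m hm => ?_⟩
  obtain ⟨k, rfl⟩ := Nat.exists_eq_add_of_le' hm
  have h1 : (T ^ (k + n)) τ - y = (T ^ k) ((T ^ n) τ - y) := by
    rw [map_sub, hpow, pow_add]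
    rfl
  rw [dist_eq_norm, h1]
  rw [dist_comm, dist_eq_norm, lt_div_iff₀ (by positivity)] at hn
  have h2 := (hT.pow k).norm_apply_le ((T ^ n) τ - y)
  rw [← hC] at h2
  have h3 := norm_nonneg ((T ^ n) τ - y)
  by_contra hcon
  push Not at hcon
  nlinarith

theorem continuous_superOp (E : SuperOp H) : Continuous E :=
  LinearMap.continuous_of_finiteDimensional E

theorem continuous_tr_mul (D : Op H) : Continuous fun X : Op H => (tr (D * X)).re :=
  Complex.continuous_re.comp <| (LinearMap.continuous_of_finiteDimensional (tr (H := H))).comp <|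
    continuous_const.mul continuous_id

theorem continuous_hsSq_mul (J : Op H) : Continuous fun X : Op H => hsSq (J * X) := by
  unfold hsSq
  refine Complex.continuous_re.comp <|
    (LinearMap.continuous_of_finiteDimensional (tr (H := H))).comp ?_
  fun_prop

theorem starProjection_mul_of_tr_orthogonal {L : Submodule ℂ H} {X : Op H} (hX : 0 ≤ X)
    (h : (tr (Lᗮ.starProjection * X)).re = 0) : L.starProjection * X = X := by
  have := mul_eq_zero_of_tr_mul (starProjection_nonneg Lᗮ) hX h
  rw [starProjection_orthogonal_eq, sub_mul, one_mul, sub_eq_zero] at this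
  exact this.symm

theorem tr_orthogonal_mul_eq_zero {L : Submodule ℂ H} {X : Op H} (h : L.starProjection * X = X) :
    (tr (Lᗮ.starProjection * X)).re = 0 := by
  rw [starProjection_orthogonal_eq, sub_mul, one_mul, h, sub_self, map_zero]
  rfl

theorem exists_tendsto_listComp_pow {E : ι → SuperOp H} {A : ι → Submodule ℂ (Op H)}
    (hE : ∀ i, IsCPTPProjectionOnto (E i) (A i)) {L : Submodule ℂ H} {σ : Op H} (hσ : 0 ≤ σ)
    (hσL : LinearMap.ker σ.toLinearMap = Lᗮ) (hσA : ∀ i, σ ∈ A i) {N : ι → Submodule ℂ H}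
    (hN : ∀ W : Submodule ℂ H, (∀ i, N i ≤ W) → Lᗮ ≤ W)
    (hf : ∀ i X, 0 ≤ X →
      (tr (Lᗮ.starProjection * E i X)).re ≤ (tr (Lᗮ.starProjection * X)).re ∧
      ((tr (Lᗮ.starProjection * X)).re ≤ (tr (Lᗮ.starProjection * E i X)).re →
        N i ≤ LinearMap.ker X.toLinearMap ∧
        LinearMap.ker (E i X).toLinearMap ≤ LinearMap.ker X.toLinearMap))
    {l : List ι} (hl : ∀ i, i ∈ l) {τ : Op H} (hτ : 0 ≤ τ) :
    ∃ y ∈ ⨅ i, A i, Tendsto (fun n : ℕ => (listComp E l ^ n) τ) atTop (𝓝 y) := by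
  have hE' (i) : IsCPTP (E i) := (hE i).1
  set T := listComp E l with hTdef
  have hT : IsCPTP T := isCPTP_listComp hE' l
  set f : Op H → ℝ := fun X => (tr (Lᗮ.starProjection * X)).re with hfdef
  have hfT {X : Op H} (hX : 0 ≤ X) := listComp_weight_step (f := f) hE' hf l hX
  have hf0 {X : Op H} (hX : 0 ≤ X) : 0 ≤ f X := tr_mul_re_nonneg (starProjection_nonneg _) hX
  set S := closure (Set.range fun n : ℕ => (T ^ n) τ) with hS
  have hSne : S.Nonempty := (Set.range_nonempty _).closure
  have hSpos : ∀ X ∈ S, 0 ≤ X := by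
    refine closure_minimal (t := Set.Ici 0) ?_ isClosed_Ici
    rintro _ ⟨n, rfl⟩
    exact (hT.pow n).map_nonneg τ hτ
  have hSc : IsCompact S := by
    refine Metric.isCompact_of_isClosed_isBounded isClosed_closure (Bornology.IsBounded.closure ?_)
    refine isBounded_iff_forall_norm_le.2 ⟨4 * Module.finrank ℂ H * ‖τ‖, ?_⟩
    rintro _ ⟨n, rfl⟩
    exact (hT.pow n).norm_apply_le τ
  have hST : ∀ X ∈ S, T X ∈ S := by
    intro X hX
    refine map_mem_closure (continuous_superOp T) hX ?_
    rintro _ ⟨n, rfl⟩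
    exact ⟨n + 1, by simp only [pow_succ']; rfl⟩
  have hfc : Continuous f := continuous_tr_mul _
  obtain ⟨x₀, hx₀, hmin⟩ := hSc.exists_isMinOn hSne hfc.continuousOn
  -- Kernel dimension is not continuous, so the second minimization uses well-foundedness rather
  -- than compactness.
  obtain ⟨y₁, ⟨hy₁, hfy₁⟩, hmin₁⟩ := WellFounded.has_min
    (InvImage.wf (fun X : Op H => Module.finrank ℂ (LinearMap.ker X.toLinearMap)) wellFounded_lt)
    {X : Op H | X ∈ S ∧ f X = f x₀} ⟨x₀, hx₀, rfl⟩
  have hy₁pos := hSpos y₁ hy₁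
  have hfx₀ : f x₀ = 0 := by
    obtain ⟨h1, h2⟩ := hfT hy₁pos
    have h3 : f x₀ ≤ f (T y₁) := hmin (hST y₁ hy₁)
    obtain ⟨h4, h5⟩ := h2 (hfy₁.trans_le h3)
    have h6 := hmin₁ (T y₁) ⟨hST y₁ hy₁, le_antisymm (h1.trans hfy₁.le) h3⟩
    have h7 := Submodule.eq_of_le_of_finrank_le h4 (not_lt.1 h6)
    have h8 := hN _ fun i => h5 h7.ge i (hl i)
    rw [← hfy₁]
    change (tr (Lᗮ.starProjection * y₁)).re = 0
    rw [tr_mul_comm, mul_starProjection_eq_zero_iff.2 h8, map_zero]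
    rfl
  obtain ⟨s, J, hs, hss, hJs, hsJ⟩ := exists_sqrt_inverse hσ hσL
  have hfix (i) : E i (s * s) = s * s := by rw [hss]; exact (hE i).apply_eq (hσA i)
  -- The zero-weight slice is nonempty, compact and mapped into itself by `T`; the weighted norm is
  -- minimized there.
  obtain ⟨y, ⟨hyS, hfy⟩, hymin⟩ := (hSc.inter_right (isClosed_singleton.preimage hfc :
    IsClosed (f ⁻¹' {0}))).exists_isMinOn ⟨x₀, hx₀, hfx₀⟩ (continuous_hsSq_mul J).continuousOn
  have hypos := hSpos y hyS
  have hTy : T y ∈ S ∩ f ⁻¹' {0} := by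
    refine ⟨hST y hyS, le_antisymm ((hfT hypos).1.trans (le_of_eq hfy)) ?_⟩
    exact hf0 (hT.map_nonneg y hypos)
  have hfixed := (listComp_hsSq_step hE' (fun i X => (hE i).apply_eq ((hE i).apply_mem X)) hs hfix
    hJs hsJ (fun i X hX hPX => starProjection_mul_of_tr_orthogonal ((hE' i).map_nonneg X hX)
      (le_antisymm ((hf i X hX).1.trans (tr_orthogonal_mul_eq_zero hPX).le)
        (hf0 ((hE' i).map_nonneg X hX)))) l hypos
    (starProjection_mul_of_tr_orthogonal hypos hfy)).2 (hymin hTy)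
  have hfixed' (i) : E i y = y := hfixed i (hl i)
  refine ⟨y, (Submodule.mem_iInf _).2 fun i => hfixed' i ▸ (hE i).apply_mem y, ?_⟩
  exact hT.tendsto_of_mem_closure (listComp_apply_eq_self hfixed' l) hyS

theorem exists_projection_tendsto {E : ι → SuperOp H} {A : ι → Submodule ℂ (Op H)}
    (hE : ∀ i, IsCPTPProjectionOnto (E i) (A i)) {l : List ι}
    (h : ∀ τ : Op H, 0 ≤ τ →
      ∃ y ∈ ⨅ i, A i, Tendsto (fun n : ℕ => (listComp E l ^ n) τ) atTop (𝓝 y)) :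
    ∃ Ehat : SuperOp H, IsCPTPProjectionOnto Ehat (⨅ i, A i) ∧
      ∀ τ : Op H, Tendsto (fun n : ℕ => (listComp E l ^ n) τ) atTop (𝓝 (Ehat τ)) := by
  -- Convergence extends from positive operators to all operators through the four-term
  -- decomposition.
  obtain ⟨Φ, hΦ⟩ := exists_linearMap_tendsto (l := atTop) (fun n : ℕ => listComp E l ^ n) fun X => by
    obtain ⟨x, hx, -, hX⟩ := CStarAlgebra.exists_sum_four_nonneg X
    choose y _ hy using fun i => h (x i) (hx i)
    refine ⟨∑ i : Fin 4, Complex.I ^ (i : ℕ) • y i, ?_⟩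
    rw [hX]
    simp only [map_sum, map_smul]
    exact tendsto_finsetSum _ fun i _ => (hy i).const_smul _
  refine ⟨Φ, .of_apply (IsCPTP.of_tendsto
    (fun n => (isCPTP_listComp (fun i => (hE i).1) l).pow n) hΦ) (fun X => ?_) fun X hX => ?_, hΦ⟩
  · obtain ⟨x, hx, -, hX⟩ := CStarAlgebra.exists_sum_four_nonneg X
    rw [hX, map_sum]
    refine Submodule.sum_mem _ fun i _ => ?_
    rw [map_smul]
    obtain ⟨y, hyA, hy⟩ := h (x i) (hx i)
    rw [tendsto_nhds_unique (hΦ (x i)) hy]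
    exact Submodule.smul_mem _ _ hyA
  · have hT := listComp_apply_eq_self
      (fun i => (hE i).apply_eq ((Submodule.mem_iInf _).1 hX i)) l
    refine tendsto_nhds_unique (hΦ X) (tendsto_const_nhds.congr fun n => ?_)
    induction n with
    | zero => rfl
    | succ n ih => rw [pow_succ]; exact ih.trans (congrArg (listComp E l ^ n) hT).symm

theorem supp_mono {A B : Submodule ℂ (Op H)} (h : A ≤ B) : supp A ≤ supp B :=
  biSup_mono fun _ hX => h hX

theorem supp_ne_bot {A : Submodule ℂ (Op H)} (h : A ≠ ⊥) : supp A ≠ ⊥ := by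
  obtain ⟨X, hX, hX0⟩ := Submodule.exists_mem_ne_zero_of_ne_bot h
  intro hs
  refine hX0 (ContinuousLinearMap.ext fun v => ?_)
  have h1 : (LinearMap.ker X.toLinearMap)ᗮ ≤ ⊥ := hs ▸ le_iSup₂_of_le X hX le_rfl
  have h2 : LinearMap.ker X.toLinearMap = ⊤ :=
    (Submodule.orthogonal_eq_bot_iff).1 (le_bot_iff.1 h1)
  exact (h2 ▸ Submodule.mem_top : v ∈ LinearMap.ker X.toLinearMap)

end Convergence

end QuantumProjections

theorem mainTheorem5 {H : Type*} [NormedAddCommGroup H] [InnerProductSpace ℂ H]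
    [FiniteDimensional ℂ H] [CompleteSpace H] {r : ℕ}
    (A : Fin r → Submodule ℂ (H →L[ℂ] H))
    (hA : ∀ i, IsCPTPFixedPointSet (A i))
    (hne : (⨅ i, A i) ≠ ⊥)
    (hsupp : supp (⨅ i, A i) = ⨅ i, supp (A i)) :
    ∃ E : Fin r → SuperOp H,
      (∀ i, IsCPTPProjectionOnto (E i) (A i)) ∧
      (∀ i, ∃ G : SuperOp (supp (A i)),
        IsCPTPProjectionOnto G ((A i).comap (extend (supp (A i)))) ∧
        E i = sumId (supp (A i)) G ∘ₗ restrictTo (supp (A i))) ∧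
      ∃ Ehat : SuperOp H,
        IsCPTPProjectionOnto Ehat (⨅ i, A i) ∧
        ∀ τ : H →L[ℂ] H, IsState τ →
          Tendsto (fun n : ℕ => (cycle E ^ n) τ) atTop (𝓝 (Ehat τ)) := by
  have hL : supp (⨅ i, A i) ≠ ⊥ := supp_ne_bot hne
  have hLK (i) : supp (⨅ i, A i) ≤ supp (A i) := supp_mono (iInf_le A i)
  have hK (i) : supp (A i) ≠ ⊥ := fun h => hL (le_bot_iff.1 (h ▸ hLK i))
  choose Φ G hΦ hG hsum hE using fun i => exists_split_projection (hA i) (hK i)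
  have hpos (i) : IsPosPartClosed (A i) := by
    obtain ⟨E, hE, h⟩ := hA i
    exact h ▸ IsPosPartClosed.fix hE
  obtain ⟨σ, hσA, hσ, hσL⟩ := (IsPosPartClosed.iInf hpos).exists_ker_eq
  have hσA' := (Submodule.mem_iInf _).1 hσA
  choose ρ hρA hρ hρK using fun i => (hpos i).exists_ker_eq
  refine ⟨fun i => Φ i ∘ₗ restrictTo (supp (A i)), hE, fun i => ⟨G i, hG i, (hsum i).symm⟩, ?_⟩
  obtain ⟨Ehat, h1, h2⟩ := exists_projection_tendsto hE (l := List.finRange r) fun τ hτ =>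
    exists_tendsto_listComp_pow hE hσ hσL hσA' (N := fun i => (supp (A i))ᗮ)
      -- The support hypothesis enters here, in dual form: `Lᗮ` lies in any subspace containing
      -- every `(supp (A i))ᗮ`.
      (fun W hW => by
        rw [← Submodule.orthogonal_orthogonal W]
        refine Submodule.orthogonal_le ?_
        rw [hsupp]
        refine le_iInf fun i => ?_
        rw [← Submodule.orthogonal_orthogonal (supp (A i))]
        exact Submodule.orthogonal_le (hW i))
      (fun i X hX => restrict_project_step (hΦ i) hL (hLK i) (hρA i) (hρ i) (hρK i) (hσA' i) hσ hσL
        hX) List.mem_finRange hτ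
  refine ⟨Ehat, h1, fun τ _ => ?_⟩
  rw [cycle_eq_listComp]
  exact h2 τ
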